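/- Let $r\ge 0$ be an integer and let $\mathbf H_r(0)$ be the $0$-Hecke algebra, i.e. the unital associative $\mathbb C$-algebra generated by $\bar\pi_1,\dots,\bar\pi_{r-1}$ with relations $\bar\pi_i^2=-\bar\pi_i$, $\bar\pi_i\bar\pi_{i+1}\bar\pi_i=\bar\pi_{i+1}\bar\pi_i\bar\pi_{i+1}$, and $\bar\pi_i\bar\pi_j=\bar\pi_j\bar\pi_i$ for $|i-j|\ge 2$; put $\pi_i:=\bar\pi_i+1$. For a permutation $w\in\mathfrak S_r$ with reduced expression $w=s_{i_1}\cdots s_{i_p}$ put $\bar\pi_w:=\bar\pi_{i_1}\cdots\bar\pi_{i_p}$ and $\pi_w:=\pi_{i_1}\cdots\pi_{i_p}$, which do not depend on the reduced expression. For $S\subseteq[r-1]:=\{1,\dots,r-1\}$ let $w_0(S)$ be the longest element of the subgroup of $\mathfrak S_r$ generated by the simple transpositions $s_i=(i\ i{+}1)$, $i\in S$. Let $\Lambda^+(r)$ be the set of compositions $\alpha=(\alpha_1,\dots,\alpha_n)$ of $r$ into positive parts, let $\mathrm{set}(\alpha):=\{\alpha_1,\alpha_1+\alpha_2,\dots,\alpha_1+\cdots+\alpha_{n-1}\}\subseteq[r-1]$,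 let $\alpha^{\mathrm r}:=(\alpha_n,\dots,\alpha_1)$, and let $\alpha^{\mathrm c}$ be the composition of $r$ with $\mathrm{set}(\alpha^{\mathrm c})=[r-1]\setminus\mathrm{set}(\alpha)$. For $\alpha\in\Lambda^+(r)$ let $$R_\alpha:=\mathbf H_r(0)\,\bar\pi_{w_0(\mathrm{set}(\alpha))}\,\pi_{w_0([r-1]\setminus\mathrm{set}(\alpha))}$$ be the corresponding projective indecomposable left $\mathbf H_r(0)$-module, and let $d_{\alpha,\beta}:=\dim_{\mathbb C}\operatorname{Hom}_{\mathbf H_r(0)}(R_\alpha,R_\beta)$ for $\alpha,\beta\in\Lambda^+(r)$ be the entries of the Cartan matrix of $\mathbf H_r(0)$. Let $D_4\times\mathbb Z_2$, where $D_4$ is the dihedral group of order $8$, act on $\Lambda^+(r)^2$ so that a rotation of order $4$ generating the rotation subgroup of $D_4$ acts by $\eta\colon(\alpha,\beta)\mapsto(\beta^{\mathrm r},\alpha)$, a reflection in $D_4$ acts by $\mathsf{ex}\colon(\alpha,\beta)\mapsto(\beta,\alpha)$, and the generator of $\mathbb Z_2$ acts by $\mathsf c\colon(\alpha,\beta)\mapsto(\alpha^{\mathrm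 c},\beta^{\mathrm c})$. Then the Cartan matrix of $\mathbf H_r(0)$ is constant on each $D_4\times\mathbb Z_2$-orbit: if $(\alpha,\beta)$ and $(\alpha',\beta')$ in $\Lambda^+(r)^2$ lie in the same orbit, then $d_{\alpha,\beta}=d_{\alpha',\beta'}$. -/

import Mathlib

noncomputable section

namespace ZeroHecke

/-! ### Compositions

A (strong) composition of `r` is Mathlib's `Composition r`, and `α ↦ αʳ` is `Composition.reverse`.
The set `[r-1] = {1, …, r-1}` is represented by `Fin (r - 1)`, where `i : Fin (r - 1)` stands for
the integer `i + 1`. -/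

/-- The bijection `α ↦ set(α) = {α₁, α₁ + α₂, …, α₁ + ⋯ + α_{n-1}}` from compositions of `r`
to subsets of `[r-1]`; see `mem_setEquiv`. -/
def setEquiv (r : ℕ) : Composition r ≃ Finset (Fin (r - 1)) :=
  (compositionEquiv r).trans (compositionAsSetEquiv r)

theorem mem_setEquiv {r : ℕ} (α : Composition r) (i : Fin (r - 1)) :
    i ∈ setEquiv r α ↔ ∃ k ≤ α.length, (α.blocks.take k).sum = (i : ℕ) + 1 := by
  simp only [setEquiv, compositionEquiv, compositionAsSetEquiv, Equiv.trans_apply,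
    Equiv.coe_fn_mk, Set.mem_toFinset, Set.mem_ofPred_eq,
    Composition.toCompositionAsSet_boundaries, Composition.boundaries, Finset.mem_map,
    Finset.mem_univ, true_and, Composition.boundary, Composition.sizeUpTo,
    OrderEmbedding.coe_ofStrictMono, RelEmbedding.coe_toEmbedding, Fin.ext_iff, add_comm 1]
  constructor
  · rintro ⟨k, hk⟩
    exact ⟨k, by omega, hk⟩
  · rintro ⟨k, hk, h⟩
    exact ⟨⟨k, by omega⟩, h⟩

/-- The complement `αᶜ`: the composition with `set(αᶜ) = [r-1] \ set(α)`. -/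
def complement {r : ℕ} (α : Composition r) : Composition r :=
  (setEquiv r).symm (setEquiv r α)ᶜ

theorem setEquiv_complement {r : ℕ} (α : Composition r) :
    setEquiv r (complement α) = (setEquiv r α)ᶜ := by
  simp [complement]

theorem complement_complement {r : ℕ} (α : Composition r) : complement (complement α) = α := by
  simp [complement]

theorem rev_mem_setEquiv_reverse {r : ℕ} (α : Composition r) (i : Fin (r - 1)) :
    i.rev ∈ setEquiv r α.reverse ↔ i ∈ setEquiv r α := by
  have key : ∀ (β : Composition r) (j : Fin (r - 1)),
      j ∈ setEquiv r β → j.rev ∈ setEquiv r β.reverse := by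
    intro β j h
    rw [mem_setEquiv] at h ⊢
    obtain ⟨k, hk, h⟩ := h
    have hl : β.blocks.length = β.length := rfl
    have hs := β.blocks_sum
    have ht := List.sum_take_add_sum_drop β.blocks k
    refine ⟨β.length - k, ?_, ?_⟩
    · simp [Composition.reverse, Composition.length]
    · simp only [Composition.reverse, List.take_reverse, List.sum_reverse, hl, Fin.val_rev]
      rw [Nat.sub_sub_self hk]
      omega
  refine ⟨fun h => ?_, key α i⟩
  simpa using key _ _ h

theorem complement_reverse {r : ℕ} (α : Composition r) :
    complement α.reverse = (complement α).reverse := by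
  apply (setEquiv r).injective
  ext i
  obtain ⟨j, rfl⟩ := Fin.rev_surjective i
  rw [rev_mem_setEquiv_reverse, setEquiv_complement, setEquiv_complement, Finset.mem_compl,
    Finset.mem_compl, rev_mem_setEquiv_reverse]

/-! ### The symmetric group: reduced words and longest elements -/

/-- The simple transposition `(i, i+1)` of the symmetric group on `r` letters. -/
def simpleTransposition {r : ℕ} (i : Fin (r - 1)) : Equiv.Perm (Fin r) :=
  Equiv.swap ⟨i, by omega⟩ ⟨i + 1, by omega⟩

/-- `l` is (the list of indices of) a reduced expression of `w`. -/
def IsReducedWord {r : ℕ} (w : Equiv.Perm (Fin r)) (l : List (Fin (r - 1))) : Prop :=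
  (l.map simpleTransposition).prod = w ∧
    ∀ l' : List (Fin (r - 1)), (l'.map simpleTransposition).prod = w → l.length ≤ l'.length

theorem exists_word {r : ℕ} (w : Equiv.Perm (Fin r)) :
    ∃ l : List (Fin (r - 1)), (l.map simpleTransposition).prod = w := by
  cases r with
  | zero => exact ⟨[], Subsingleton.elim _ _⟩
  | succ n =>
    have hw : w ∈ Submonoid.closure
        (Set.range fun i : Fin n ↦ Equiv.swap i.castSucc i.succ) := by
      rw [Equiv.Perm.mclosure_swap_castSucc_succ]; trivial
    induction hw using Submonoid.closure_induction with
    | mem x hx =>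
      obtain ⟨i, rfl⟩ := hx
      exact ⟨[i], by simp [simpleTransposition]; rfl⟩
    | one => exact ⟨[], rfl⟩
    | mul x y _ _ hx hy =>
      obtain ⟨a, rfl⟩ := hx
      obtain ⟨b, rfl⟩ := hy
      exact ⟨a ++ b, by simp⟩

theorem exists_reducedWord {r : ℕ} (w : Equiv.Perm (Fin r)) :
    ∃ l : List (Fin (r - 1)), IsReducedWord w l := by
  obtain ⟨l, hl, hmin⟩ := (measure (List.length (α := Fin (r - 1)))).wf.has_min
    {l | (l.map simpleTransposition).prod = w} (exists_word w)
  exact ⟨l, hl, fun l' hl' => not_lt.mp (hmin l' hl')⟩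

/-- A chosen reduced expression of `w`. -/
def reducedWord {r : ℕ} (w : Equiv.Perm (Fin r)) : List (Fin (r - 1)) :=
  (exists_reducedWord w).choose

theorem isReducedWord_reducedWord {r : ℕ} (w : Equiv.Perm (Fin r)) :
    IsReducedWord w (reducedWord w) :=
  (exists_reducedWord w).choose_spec

/-- The length `ℓ(w)`: the length of a reduced expression of `w`. -/
def permLength {r : ℕ} (w : Equiv.Perm (Fin r)) : ℕ :=
  (reducedWord w).length

/-- The parabolic subgroup generated by the `s_i` with `i ∈ S`. -/
def parabolic {r : ℕ} (S : Finset (Fin (r - 1))) : Subgroup (Equiv.Perm (Fin r)) :=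
  Subgroup.closure (simpleTransposition '' (S : Set (Fin (r - 1))))

theorem exists_longest {r : ℕ} (S : Finset (Fin (r - 1))) :
    ∃ w ∈ parabolic S, ∀ u ∈ parabolic S, permLength u ≤ permLength w :=
  Set.exists_max_image (parabolic S : Set (Equiv.Perm (Fin r))) permLength
    (Set.toFinite _) ⟨1, one_mem _⟩

/-- `w₀(S)`, the longest element of the parabolic subgroup of `S`. -/
def longest {r : ℕ} (S : Finset (Fin (r - 1))) : Equiv.Perm (Fin r) :=
  (exists_longest S).choose

theorem longest_spec {r : ℕ} (S : Finset (Fin (r - 1))) :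
    longest S ∈ parabolic S ∧ ∀ u ∈ parabolic S, permLength u ≤ permLength (longest S) :=
  (exists_longest S).choose_spec

/-! ### The 0-Hecke algebra -/

/-- The defining relations of the 0-Hecke algebra in the generators `π̄_i`. -/
inductive Rel (r : ℕ) :
    FreeAlgebra ℂ (Fin (r - 1)) → FreeAlgebra ℂ (Fin (r - 1)) → Prop
  | quad (i : Fin (r - 1)) :
      Rel r (FreeAlgebra.ι ℂ i * FreeAlgebra.ι ℂ i) (-FreeAlgebra.ι ℂ i)
  | braid (i j : Fin (r - 1)) (h : (i : ℕ) + 1 = j) :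
      Rel r (FreeAlgebra.ι ℂ i * FreeAlgebra.ι ℂ j * FreeAlgebra.ι ℂ i)
        (FreeAlgebra.ι ℂ j * FreeAlgebra.ι ℂ i * FreeAlgebra.ι ℂ j)
  | comm (i j : Fin (r - 1)) (h : (i : ℕ) + 2 ≤ j ∨ (j : ℕ) + 2 ≤ i) :
      Rel r (FreeAlgebra.ι ℂ i * FreeAlgebra.ι ℂ j) (FreeAlgebra.ι ℂ j * FreeAlgebra.ι ℂ i)

/-- The 0-Hecke algebra `H_r(0)` over `ℂ`. -/
abbrev Hecke (r : ℕ) : Type := RingQuot (Rel r)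

/-- The generator `π̄_i`, with `π̄_i² = -π̄_i`. -/
def opi {r : ℕ} (i : Fin (r - 1)) : Hecke r :=
  RingQuot.mkAlgHom ℂ (Rel r) (FreeAlgebra.ι ℂ i)

/-- The generator `π_i = π̄_i + 1`. -/
def pi {r : ℕ} (i : Fin (r - 1)) : Hecke r := opi i + 1

/-- `π̄_w`, the product of the `π̄_i` along a reduced expression of `w`. -/
def opiPerm {r : ℕ} (w : Equiv.Perm (Fin r)) : Hecke r :=
  ((reducedWord w).map opi).prod

/-- `π_w`, the product of the `π_i` along a reduced expression of `w`. -/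
def piPerm {r : ℕ} (w : Equiv.Perm (Fin r)) : Hecke r :=
  ((reducedWord w).map pi).prod

/-- The projective indecomposable module
`R_α = H_r(0) π̄_{w₀(set(α))} π_{w₀([r-1] \ set(α))}`, a left ideal of `H_r(0)`. -/
def projIndec {r : ℕ} (α : Composition r) : Submodule (Hecke r) (Hecke r) :=
  Submodule.span (Hecke r)
    {opiPerm (longest (setEquiv r α)) * piPerm (longest (setEquiv r α)ᶜ)}

/-- The Cartan matrix of `H_r(0)`: `d_{α,β} = dim_ℂ Hom_{H_r(0)}(R_α, R_β)`. -/
def cartan (r : ℕ) : Matrix (Composition r) (Composition r) ℕ :=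
  Matrix.of fun α β => Module.finrank ℂ (projIndec α →ₗ[Hecke r] projIndec β)

/-! ### The action of `D₄ × ℤ₂` on pairs of compositions -/

/-- `ex (α, β) = (β, α)`. -/
def ex (r : ℕ) : Equiv.Perm (Composition r × Composition r) where
  toFun p := (p.2, p.1)
  invFun p := (p.2, p.1)
  left_inv _ := rfl
  right_inv _ := rfl

/-- `c (α, β) = (αᶜ, βᶜ)`. -/
def compl (r : ℕ) : Equiv.Perm (Composition r × Composition r) where
  toFun p := (complement p.1, complement p.2)
  invFun p := (complement p.1, complement p.2)
  left_inv p := by simp [complement_complement]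
  right_inv p := by simp [complement_complement]

/-- `η (α, β) = (βʳ, α)`. -/
def eta (r : ℕ) : Equiv.Perm (Composition r × Composition r) where
  toFun p := (p.2.reverse, p.1)
  invFun p := (p.2, p.1.reverse)
  left_inv p := by simp
  right_inv p := by simp

theorem ex_mul_ex (r : ℕ) : ex r * ex r = 1 := rfl

theorem compl_mul_compl (r : ℕ) : compl r * compl r = 1 := by
  ext1 p
  simp [compl, complement_complement]

theorem eta_pow_four (r : ℕ) : eta r ^ 4 = 1 := by
  ext1 p
  simp [eta, pow_succ]

theorem eta_mul_ex (r : ℕ) : eta r * ex r = ex r * (eta r)⁻¹ := by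
  ext1 p
  apply (ex r).injective
  simp [eta, ex, Equiv.Perm.inv_def]

theorem ex_commute_compl (r : ℕ) : Commute (ex r) (compl r) := rfl

theorem eta_commute_compl (r : ℕ) : Commute (eta r) (compl r) := by
  ext1 p
  simp [eta, compl, complement_reverse]

/-- The homomorphism from the dihedral group of order 8 with `r 1 ↦ η` and `sr 0 ↦ ex`. -/
def dihedralHom (r : ℕ) : DihedralGroup 4 →* Equiv.Perm (Composition r × Composition r) where
  toFun
    | .r i => eta r ^ i.val
    | .sr i => ex r * eta r ^ i.val
  map_one' := by
    change eta r ^ (0 : ZMod 4).val = 1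
    simp
  map_mul' := by
    have h4 := eta_pow_four r
    have hadd : ∀ i j : ZMod 4, eta r ^ (i + j).val = eta r ^ i.val * eta r ^ j.val := by
      intro i j
      rw [ZMod.val_add, ← pow_add, ← pow_eq_pow_mod _ h4]
    have hconj : ∀ n : ℕ, eta r ^ n * ex r = ex r * (eta r ^ n)⁻¹ := by
      intro n
      induction n with
      | zero => simp
      | succ n ih =>
        rw [pow_succ, mul_assoc, eta_mul_ex, ← mul_assoc, ih, mul_assoc, ← mul_inv_rev,
          ← pow_succ', pow_succ]
    have hsub : ∀ i j : ZMod 4, eta r ^ (i - j).val = (eta r ^ j.val)⁻¹ * eta r ^ i.val := by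
      intro i j
      rw [eq_inv_mul_iff_mul_eq, ← hadd, add_sub_cancel]
    rintro (i | i) (j | j)
    · exact hadd i j
    · change ex r * eta r ^ (j - i).val = eta r ^ i.val * (ex r * eta r ^ j.val)
      rw [hsub, ← mul_assoc, ← mul_assoc, hconj]
    · change ex r * eta r ^ (i + j).val = ex r * eta r ^ i.val * eta r ^ j.val
      rw [hadd, mul_assoc]
    · change eta r ^ (j - i).val = ex r * eta r ^ i.val * (ex r * eta r ^ j.val)
      rw [hsub, mul_assoc, ← mul_assoc (eta r ^ i.val), hconj, ← mul_assoc, ← mul_assoc,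
        ex_mul_ex, one_mul]

/-- The homomorphism from `ℤ₂` sending the generator to `c`. -/
def complHom (r : ℕ) :
    Multiplicative (ZMod 2) →* Equiv.Perm (Composition r × Composition r) where
  toFun k := compl r ^ k.toAdd.val
  map_one' := by simp
  map_mul' j k := by
    have h2 : compl r ^ 2 = 1 := by rw [pow_two, compl_mul_compl]
    rw [toAdd_mul, ZMod.val_add, ← pow_add, ← pow_eq_pow_mod _ h2]

theorem dihedralHom_commute_complHom (r : ℕ) (g : DihedralGroup 4)
    (k : Multiplicative (ZMod 2)) : Commute (dihedralHom r g) (complHom r k) := by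
  refine Commute.pow_right ?_ _
  rcases g with i | i
  · exact (eta_commute_compl r).pow_left _
  · exact (ex_commute_compl r).mul_left ((eta_commute_compl r).pow_left _)

/-- The homomorphism `D₄ × ℤ₂ → ⟨ex, c, η⟩`. -/
def actionHom (r : ℕ) : DihedralGroup 4 × Multiplicative (ZMod 2) →*
    Equiv.Perm (Composition r × Composition r) :=
  (dihedralHom r).noncommCoprod (complHom r) (dihedralHom_commute_complHom r)

/-- The action of `D₄ × ℤ₂` on pairs of compositions of `r`. -/
instance pairAction (r : ℕ) : MulAction (DihedralGroup 4 × Multiplicative (ZMod 2))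
    (Composition r × Composition r) :=
  MulAction.compHom _ (actionHom r)

theorem smul_rotation {r : ℕ} (α β : Composition r) :
    ((DihedralGroup.r 1, 1) : DihedralGroup 4 × Multiplicative (ZMod 2)) • (α, β)
      = (β.reverse, α) := by
  change (eta r ^ 1 * compl r ^ 0) (α, β) = _
  simp [eta]

theorem smul_reflection {r : ℕ} (α β : Composition r) :
    ((DihedralGroup.sr 0, 1) : DihedralGroup 4 × Multiplicative (ZMod 2)) • (α, β)
      = (β, α) := by
  change (ex r * eta r ^ 0 * compl r ^ 0) (α, β) = _
  simp [ex]

theorem smul_complement {r : ℕ} (α β : Composition r) :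
    ((1, Multiplicative.ofAdd 1) : DihedralGroup 4 × Multiplicative (ZMod 2)) • (α, β)
      = (complement α, complement β) := by
  change (eta r ^ 0 * compl r ^ 1) (α, β) = _
  simp [compl]

end ZeroHecke

end

/-! If `a` lies in `A a²` and in `a² A`, then `Hom_A(A a, A b)` is the subspace `a A b` of `A`. The
generators `e_α = π̄_{w₀(S)} π_{w₀(Sᶜ)}`, `S = set(α)`, of the projective indecomposable modules
have this property: it amounts to `x e_α² = 0 → x e_α = 0`, which follows by comparing coefficients
of the permutations with descent set exactly `S`, in order of length. So `d_{α,β} = dim e_α H e_β`,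
a number that does not change when the two factors of both generators are exchanged.

* The anti-automorphism fixing the `π̄_i` exchanges the two factors of `e_α`, so
  `d_{α,β} = d_{β,α}`.
* The automorphism `-π̄_i ↦ π_i` sends `e_α` to `e_{αᶜ}` with its factors exchanged, so
  `d_{αᶜ,βᶜ} = d_{α,β}`.
* The coefficient of the longest permutation is a nondegenerate form with Nakayama automorphism
  `ν : π̄_i ↦ π̄_{r-i}`. Taking adjoints with respect to it gives `dim a A b = dim b A ν(a)`, so
  `d_{α,β} = d_{β,αʳ}`.
-/

noncomputable section

namespace ZeroHecke

open Equiv (Perm)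

/-! ### Group invertible elements and the spaces `aAb` -/

section GroupInvertible

open Module (finrank)
open MulOpposite (op)

/-- `a` is group invertible if some `s` commuting with it satisfies `a * a * s = a`. For such an
`a`, homomorphisms out of the left ideal generated by `a` are right multiplications. -/
def IsGroupInvertible {M : Type*} [Mul M] (a : M) : Prop :=
  ∃ s, Commute a s ∧ a * a * s = a

theorem IsGroupInvertible.map {M N F : Type*} [Mul M] [Mul N] [FunLike F M N] [MulHomClass F M N]
    {a : M} (ha : IsGroupInvertible a) (f : F) : IsGroupInvertible (f a) := by
  obtain ⟨s, hcomm, hs⟩ := ha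
  exact ⟨f s, hcomm.map f, by rw [← map_mul, ← map_mul, hs]⟩

theorem isGroupInvertible_of_mul_mul_eq {M : Type*} [Semigroup M] {a c d : M}
    (hc : c * a * a = a) (hd : a * a * d = a) : IsGroupInvertible a := by
  have hcd : c * a = a * d := by
    calc c * a = c * a * a * d := by rw [mul_assoc, mul_assoc, ← mul_assoc a, hd]
      _ = a * d := by rw [hc]
  have hleft : a * (c * a * d) = a * d := by
    rw [hcd, ← mul_assoc, ← mul_assoc, hd]
  have hright : c * a * d * a = a * d := by
    rw [mul_assoc, mul_assoc, ← mul_assoc a d, ← hcd, hc, hcd]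
  refine ⟨c * a * d, hleft.trans hright.symm, ?_⟩
  rw [mul_assoc, hleft, ← mul_assoc, hd]

theorem exists_apply_apply_eq_apply {R V : Type*} [Ring R] [AddCommGroup V] [Module R V]
    [IsArtinian R V] (T : V →ₗ[R] V) (hT : ∀ v, T (T v) = 0 → T v = 0) (v : V) :
    ∃ z, T (T z) = T v := by
  let U : LinearMap.range T →ₗ[R] LinearMap.range T := T.restrict fun x _ => ⟨x, rfl⟩
  have hU : Function.Injective U := by
    rw [injective_iff_map_eq_zero]
    rintro ⟨_, x, rfl⟩ hx
    exact Subtype.ext (hT x (congrArg Subtype.val hx))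
  obtain ⟨⟨_, z, rfl⟩, hz⟩ := IsArtinian.surjective_of_injective_endomorphism U hU ⟨T v, v, rfl⟩
  exact ⟨z, congrArg Subtype.val hz⟩

section CommRing

variable {K A B : Type*} [CommRing K] [Ring A] [Algebra K A] [Ring B] [Algebra K B]

variable (K) in
theorem isGroupInvertible_of_forall_mul_mul_eq_zero [IsArtinian K A] {a : A}
    (ha : ∀ h, h * a * a = 0 → h * a = 0) : IsGroupInvertible a := by
  obtain ⟨c, hc⟩ := exists_apply_apply_eq_apply (LinearMap.mulRight K a) (by simpa using ha) 1
  have hc' : c * a * a = a := by simpa using hc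
  obtain ⟨d, hd⟩ := exists_apply_apply_eq_apply (LinearMap.mulLeft K a) (fun h hh => by
    simp only [LinearMap.mulLeft_apply] at hh ⊢
    rw [← hc', mul_assoc, mul_assoc, hh, mul_zero]) 1
  exact isGroupInvertible_of_mul_mul_eq hc' (by simpa [mul_assoc] using hd)

variable (K) in
/-- The dimension of the subspace `a A b`, realized as the range of `x ↦ a * x * b`. -/
def cornerRank (a b : A) : ℕ :=
  finrank K (LinearMap.range (LinearMap.mulLeftRight K (a, b)))

theorem finrank_hom_span_singleton {a : A} (ha : IsGroupInvertible a) (b : A) :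
    finrank K (Submodule.span A {a} →ₗ[A] Submodule.span A {b}) = cornerRank K a b := by
  obtain ⟨s, hcomm, hs⟩ := ha
  let g : Submodule.span A {a} := ⟨a, Submodule.mem_span_singleton_self a⟩
  have hg : (a * s) • g = g := Subtype.ext <| by
    change a * s * a = a
    rw [mul_assoc, ← hcomm.eq, ← mul_assoc, hs]
  let eval : (Submodule.span A {a} →ₗ[A] Submodule.span A {b}) →ₗ[K] A :=
    { toFun := fun f => f g
      map_add' := fun _ _ => rfl
      map_smul' := fun _ _ => rfl }
  have eval_injective : Function.Injective eval := by
    intro f f' hff'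
    ext ⟨x, hx⟩
    obtain ⟨c, rfl⟩ := Submodule.mem_span_singleton.mp hx
    change (f (c • g) : A) = f' (c • g)
    rw [map_smul, map_smul, Subtype.ext hff']
  have range_eval : LinearMap.range eval = LinearMap.range (LinearMap.mulLeftRight K (a, b)) := by
    ext x
    simp only [LinearMap.mem_range, LinearMap.mulLeftRight_apply]
    constructor
    · rintro ⟨f, rfl⟩
      obtain ⟨k, hk⟩ := Submodule.mem_span_singleton.mp (f g).2
      refine ⟨s * k, ?_⟩
      change _ = (f g : A)
      rw [← hg, map_smul, Submodule.coe_smul, ← hk]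
      simp only [smul_eq_mul, mul_assoc]
    · rintro ⟨h, rfl⟩
      refine ⟨((LinearMap.toSpanSingleton A A (h * b)).domRestrict _).codRestrict _ ?_, ?_⟩
      · rintro ⟨x, hx⟩
        exact Submodule.mem_span_singleton.mpr ⟨x * h, by simp [mul_assoc]⟩
      · change a * (h * b) = _
        rw [mul_assoc]
  rw [cornerRank, ← range_eval]
  exact (LinearEquiv.ofInjective eval eval_injective).finrank_eq

theorem finrank_range_eq_of_intertwine {V W : Type*} [AddCommGroup V] [Module K V] [AddCommGroup W]
    [Module K W] (e : V ≃ₗ[K] W) {f : V →ₗ[K] V} {g : W →ₗ[K] W} (h : ∀ v, e (f v) = g (e v)) :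
    finrank K (LinearMap.range f) = finrank K (LinearMap.range g) := by
  have hconj : e.toLinearMap ∘ₗ f = g ∘ₗ e.toLinearMap := LinearMap.ext h
  have hrange : LinearMap.range g = (LinearMap.range f).map e.toLinearMap := by
    rw [← LinearMap.range_comp, hconj, LinearMap.range_comp_of_range_eq_top _ e.range]
  rw [hrange]
  exact (LinearEquiv.finrank_map_eq e _).symm

theorem cornerRank_map (e : A ≃ₐ[K] B) (a b : A) :
    cornerRank K (e a) (e b) = cornerRank K a b :=
  (finrank_range_eq_of_intertwine e.toLinearEquiv fun x => by simp).symm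

theorem cornerRank_op (a b : A) : cornerRank K (op a) (op b) = cornerRank K b a :=
  (finrank_range_eq_of_intertwine (MulOpposite.opLinearEquiv K) fun x => by simp [mul_assoc]).symm

end CommRing

section Field

variable {K A : Type*} [Field K] [Ring A] [Algebra K A] [Module.Finite K A]

theorem cornerRank_mul_mul_le (u a v x b y : A) :
    cornerRank K (u * a * v) (x * b * y) ≤ cornerRank K a b := by
  have hfactor : LinearMap.mulLeftRight K (u * a * v, x * b * y) =
      LinearMap.mulLeftRight K (u, y) ∘ₗ LinearMap.mulLeftRight K (a, b) ∘ₗ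
        LinearMap.mulLeftRight K (v, x) := by
    ext z
    simp [mul_assoc]
  rw [cornerRank, hfactor, LinearMap.range_comp]
  exact (Submodule.finrank_map_le _ _).trans
    (Submodule.finrank_mono (LinearMap.range_comp_le_range _ _))

theorem cornerRank_mul_le_swap {a b x y : A} (hab : IsGroupInvertible (a * b))
    (hxy : IsGroupInvertible (x * y)) :
    cornerRank K (a * b) (x * y) ≤ cornerRank K (b * a) (y * x) := by
  obtain ⟨s, hcomm, hs⟩ := hab
  obtain ⟨t, -, ht⟩ := hxy
  have hleft : a * b = s * a * (b * a) * b := by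
    calc a * b = a * b * (s * (a * b)) := by rw [← hcomm.eq, ← mul_assoc, hs]
      _ = s * a * (b * a) * b := by rw [← mul_assoc, hcomm.eq]; simp only [mul_assoc]
  have hright : x * y = x * (y * x) * (y * t) := by
    calc x * y = x * y * (x * y) * t := ht.symm
      _ = x * (y * x) * (y * t) := by simp only [mul_assoc]
  rw [hleft, hright]
  exact cornerRank_mul_mul_le _ _ _ _ _ _

theorem cornerRank_mul_swap {a b x y : A} (hab : IsGroupInvertible (a * b))
    (hxy : IsGroupInvertible (x * y)) (hba : IsGroupInvertible (b * a))
    (hyx : IsGroupInvertible (y * x)) :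
    cornerRank K (a * b) (x * y) = cornerRank K (b * a) (y * x) :=
  le_antisymm (cornerRank_mul_le_swap hab hxy) (cornerRank_mul_le_swap hba hyx)

theorem cornerRank_eq_of_form (L : A →ₗ[K] K) (ν : A → A)
    (hL : ∀ g h, L (g * h) = L (h * ν g)) (nondeg : ∀ x, (∀ k, L (x * k) = 0) → x = 0)
    (a b : A) : cornerRank K a b = cornerRank K b (ν a) := by
  let form : A →ₗ[K] Module.Dual K A := (LinearMap.mul K A).compr₂ L
  have form_injective : Function.Injective form :=
    (injective_iff_map_eq_zero form).mpr fun x hx => nondeg x fun k => LinearMap.congr_fun hx k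
  let formEquiv : A ≃ₗ[K] Module.Dual K A :=
    LinearEquiv.ofInjectiveOfFinrankEq form form_injective Subspace.dual_finrank_eq.symm
  have hadjoint (x : A) : formEquiv (LinearMap.mulLeftRight K (a, b) x) =
      (LinearMap.mulLeftRight K (b, ν a)).dualMap (formEquiv x) := by
    ext k
    change L (a * x * b * k) = L (x * (b * k * ν a))
    rw [mul_assoc, mul_assoc, hL]
    simp only [mul_assoc]
  rw [cornerRank, finrank_range_eq_of_intertwine formEquiv hadjoint,
    LinearMap.finrank_range_dualMap_eq_finrank_range, cornerRank]

end Field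

end GroupInvertible

section SymmetricGroup

variable {r : ℕ} {w : Perm (Fin r)} {i j : Fin (r - 1)} {l : List (Fin (r - 1))}

/-- The smaller of the two positions exchanged by `simpleTransposition i`. -/
def lo (i : Fin (r - 1)) : Fin r := ⟨i, by omega⟩

/-- The larger of the two positions exchanged by `simpleTransposition i`. -/
def hi (i : Fin (r - 1)) : Fin r := ⟨i + 1, by omega⟩

@[simp] theorem val_lo (i : Fin (r - 1)) : (lo i : ℕ) = i := rfl

@[simp] theorem val_hi (i : Fin (r - 1)) : (hi i : ℕ) = i + 1 := rfl

theorem lo_lt_hi (i : Fin (r - 1)) : lo i < hi i := by simp [Fin.lt_def]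

theorem lo_eq_hi_of_succ (h : (i : ℕ) + 1 = j) : lo j = hi i := by simp [Fin.ext_iff, h]

@[simp] theorem rev_lo (i : Fin (r - 1)) : (lo i).rev = hi i.rev := by
  simp only [Fin.ext_iff, Fin.val_rev, val_lo, val_hi]
  omega

@[simp] theorem rev_hi (i : Fin (r - 1)) : (hi i).rev = lo i.rev := by
  simp only [Fin.ext_iff, Fin.val_rev, val_lo, val_hi]
  omega

theorem simpleTransposition_eq_swap (i : Fin (r - 1)) :
    simpleTransposition i = Equiv.swap (lo i) (hi i) := rfl

@[simp] theorem simpleTransposition_lo (i : Fin (r - 1)) :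
    simpleTransposition i (lo i) = hi i :=
  Equiv.swap_apply_left _ _

@[simp] theorem simpleTransposition_hi (i : Fin (r - 1)) :
    simpleTransposition i (hi i) = lo i :=
  Equiv.swap_apply_right _ _

theorem simpleTransposition_of_ne {k : Fin r} (hlo : k ≠ lo i) (hhi : k ≠ hi i) :
    simpleTransposition i k = k :=
  Equiv.swap_apply_of_ne_of_ne hlo hhi

@[simp] theorem simpleTransposition_mul_self (i : Fin (r - 1)) :
    simpleTransposition i * simpleTransposition i = 1 :=
  Equiv.swap_mul_self _ _

@[simp] theorem simpleTransposition_inv (i : Fin (r - 1)) :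
    (simpleTransposition i)⁻¹ = simpleTransposition i :=
  Equiv.swap_inv _ _

@[simp] theorem mul_simpleTransposition_mul_self (w : Perm (Fin r)) (i : Fin (r - 1)) :
    w * simpleTransposition i * simpleTransposition i = w := by
  rw [mul_assoc, simpleTransposition_mul_self, mul_one]

theorem simpleTransposition_mem_parabolic {S : Finset (Fin (r - 1))} (hi : i ∈ S) :
    simpleTransposition i ∈ parabolic S :=
  Subgroup.subset_closure ⟨i, hi, rfl⟩

theorem revPerm_mul_revPerm : (Fin.revPerm * Fin.revPerm : Perm (Fin r)) = 1 := by
  ext; simp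

theorem revPerm_mul_simpleTransposition_mul_revPerm (i : Fin (r - 1)) :
    Fin.revPerm * simpleTransposition i * Fin.revPerm = simpleTransposition i.rev := by
  rw [simpleTransposition_eq_swap, Equiv.mul_swap_eq_swap_mul, mul_assoc, revPerm_mul_revPerm,
    mul_one, Fin.revPerm_apply, Fin.revPerm_apply, rev_lo, rev_hi, Equiv.swap_comm]
  rfl

/-- `i` is a right descent of `w`. -/
def IsDescent (w : Perm (Fin r)) (i : Fin (r - 1)) : Prop := w (hi i) < w (lo i)

instance (w : Perm (Fin r)) : DecidablePred (IsDescent w) :=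
  fun i => inferInstanceAs (Decidable (w (hi i) < w (lo i)))

theorem not_isDescent_iff : ¬ IsDescent w i ↔ w (lo i) < w (hi i) := by
  rw [IsDescent, not_lt, le_iff_lt_or_eq, or_iff_left (w.injective.ne (lo_lt_hi i).ne)]

theorem isDescent_mul_simpleTransposition_self :
    IsDescent (w * simpleTransposition i) i ↔ ¬ IsDescent w i := by
  rw [not_isDescent_iff]
  simp [IsDescent]

theorem mul_simpleTransposition_ne (w : Perm (Fin r)) (i : Fin (r - 1)) :
    w * simpleTransposition i ≠ w := by
  intro h
  have hself := isDescent_mul_simpleTransposition_self (w := w) (i := i)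
  rw [h] at hself
  exact iff_not_self hself

theorem isDescent_revPerm_mul : IsDescent (Fin.revPerm * w) i ↔ ¬ IsDescent w i := by
  rw [not_isDescent_iff]
  simp [IsDescent]

theorem isDescent_mul_revPerm : IsDescent (w * Fin.revPerm) i ↔ ¬ IsDescent w i.rev := by
  rw [not_isDescent_iff]
  simp [IsDescent]

theorem isDescent_revPerm (i : Fin (r - 1)) : IsDescent Fin.revPerm i := by
  simpa [IsDescent] using lo_lt_hi i.rev

theorem strictMono_of_lo_lt_hi {f : Fin r → Fin r} (h : ∀ i, f (lo i) < f (hi i)) :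
    StrictMono f := by
  cases r with
  | zero => exact fun a => a.elim0
  | succ n => exact Fin.strictMono_iff_lt_succ.mpr h

theorem eq_one_of_forall_not_isDescent (h : ∀ i, ¬ IsDescent w i) : w = 1 := by
  have hmono : StrictMono w := strictMono_of_lo_lt_hi fun i => not_isDescent_iff.mp (h i)
  have hrefl : hmono.orderIsoOfSurjective w w.surjective = OrderIso.refl _ := Subsingleton.elim _ _
  ext1 k
  exact congrArg (· k) hrefl

/-! ### Length and inversions -/

/-- The inversions of `w`; their number is the length of `w`. -/
def inversions (w : Perm (Fin r)) : Finset (Fin r × Fin r) :=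
  Finset.univ.filter fun p => p.1 < p.2 ∧ w p.2 < w p.1

theorem mem_inversions {p : Fin r × Fin r} :
    p ∈ inversions w ↔ p.1 < p.2 ∧ w p.2 < w p.1 := by simp [inversions]

theorem inversions_one : inversions (1 : Perm (Fin r)) = ∅ := by
  ext p
  simpa [mem_inversions] using le_of_lt

theorem simpleTransposition_lt_iff {a b : Fin r} (h : ¬ (a = lo i ∧ b = hi i))
    (h' : ¬ (a = hi i ∧ b = lo i)) : simpleTransposition i a < simpleTransposition i b ↔ a < b := by
  rw [simpleTransposition_eq_swap, Equiv.swap_apply_def, Equiv.swap_apply_def]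
  simp only [Fin.ext_iff, Fin.lt_def, val_lo, val_hi] at *
  split_ifs <;> simp only [val_lo, val_hi] <;> omega

theorem inversions_mul_simpleTransposition (h : ¬ IsDescent w i) :
    inversions (w * simpleTransposition i) = insert (lo i, hi i) ((inversions w).map
      ((simpleTransposition i).prodCongr (simpleTransposition i)).toEmbedding) := by
  have hlt := not_isDescent_iff.mp h
  have hsymm : (simpleTransposition i).symm = simpleTransposition i := Equiv.symm_swap _ _
  ext ⟨a, b⟩
  simp only [Finset.mem_insert, Finset.mem_map_equiv, mem_inversions, Prod.mk.injEq,
    Equiv.Perm.mul_apply, Equiv.prodCongr_symm, Equiv.prodCongr_apply, Prod.map_apply, hsymm]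
  by_cases hab : a = lo i ∧ b = hi i
  · obtain ⟨rfl, rfl⟩ := hab
    simpa [lo_lt_hi] using hlt
  by_cases hba : a = hi i ∧ b = lo i
  · obtain ⟨rfl, rfl⟩ := hba
    simp [(lo_lt_hi i).not_gt, (lo_lt_hi i).ne', hlt.not_gt]
  · rw [simpleTransposition_lt_iff hab hba, or_iff_right hab]

theorem card_inversions_mul_simpleTransposition (h : ¬ IsDescent w i) :
    (inversions (w * simpleTransposition i)).card = (inversions w).card + 1 := by
  rw [inversions_mul_simpleTransposition h, Finset.card_insert_of_notMem, Finset.card_map]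
  simp only [Finset.mem_map_equiv, mem_inversions]
  simp [simpleTransposition_eq_swap, (lo_lt_hi i).not_gt]

theorem card_inversions_mul_simpleTransposition_of_isDescent (h : IsDescent w i) :
    (inversions (w * simpleTransposition i)).card + 1 = (inversions w).card := by
  rw [← card_inversions_mul_simpleTransposition (isDescent_mul_simpleTransposition_self.not.mpr
    (not_not.mpr h)), mul_simpleTransposition_mul_self]

theorem descent_induction {motive : Perm (Fin r) → Prop} (one : motive 1)
    (step : ∀ w i, IsDescent w i → motive (w * simpleTransposition i) → motive w)
    (w : Perm (Fin r)) : motive w := by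
  induction hn : (inversions w).card generalizing w with
  | zero =>
    have hw : w = 1 := eq_one_of_forall_not_isDescent fun i h => by
      have := card_inversions_mul_simpleTransposition_of_isDescent h
      omega
    exact hw ▸ one
  | succ n ih =>
    obtain ⟨i, h⟩ : ∃ i, IsDescent w i := by
      by_contra! h
      simp [eq_one_of_forall_not_isDescent h, inversions_one] at hn
    have := card_inversions_mul_simpleTransposition_of_isDescent h
    exact step w i h (ih _ (by omega))

theorem card_inversions_prod_le (l : List (Fin (r - 1))) :
    (inversions (l.map simpleTransposition).prod).card ≤ l.length := by
  induction l using List.reverseRecOn with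
  | nil => simp [inversions_one]
  | append_singleton l i ih =>
    simp only [List.map_append, List.prod_append, List.map_singleton, List.prod_singleton,
      List.length_append, List.length_singleton]
    by_cases h : IsDescent (l.map simpleTransposition).prod i
    · have := card_inversions_mul_simpleTransposition_of_isDescent h
      omega
    · rw [card_inversions_mul_simpleTransposition h]
      omega

theorem exists_word_length_eq_card_inversions (w : Perm (Fin r)) :
    ∃ l : List (Fin (r - 1)),
      (l.map simpleTransposition).prod = w ∧ l.length = (inversions w).card := by
  induction w using descent_induction with
  | one => exact ⟨[], by simp [inversions_one]⟩
  | step w i h ih =>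
    obtain ⟨l, hprod, hlength⟩ := ih
    exact ⟨l ++ [i], by simp [hprod],
      by simp [hlength, card_inversions_mul_simpleTransposition_of_isDescent h]⟩

theorem permLength_eq_card_inversions (w : Perm (Fin r)) :
    permLength w = (inversions w).card := by
  obtain ⟨hprod, hmin⟩ := isReducedWord_reducedWord w
  obtain ⟨l, hl, hlength⟩ := exists_word_length_eq_card_inversions w
  refine le_antisymm (hlength ▸ hmin l hl) ?_
  conv_lhs => rw [← hprod]
  exact card_inversions_prod_le _

theorem permLength_mul_simpleTransposition (h : ¬ IsDescent w i) :
    permLength (w * simpleTransposition i) = permLength w + 1 := by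
  simpa only [permLength_eq_card_inversions] using card_inversions_mul_simpleTransposition h

theorem permLength_mul_simpleTransposition_of_isDescent (h : IsDescent w i) :
    permLength (w * simpleTransposition i) + 1 = permLength w := by
  simpa only [permLength_eq_card_inversions] using
    card_inversions_mul_simpleTransposition_of_isDescent h

theorem isReducedWord_iff :
    IsReducedWord w l ↔ (l.map simpleTransposition).prod = w ∧ l.length = permLength w := by
  obtain ⟨hprod, hmin⟩ := isReducedWord_reducedWord w
  constructor
  · rintro ⟨h, h'⟩
    exact ⟨h, le_antisymm (h' _ hprod) (hmin _ h)⟩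
  · rintro ⟨h, h'⟩
    exact ⟨h, fun l' hl' => h' ▸ hmin l' hl'⟩

theorem isReducedWord_append_singleton :
    IsReducedWord w (l ++ [i]) ↔ IsDescent w i ∧ IsReducedWord (w * simpleTransposition i) l := by
  have hlt (h : (l.map simpleTransposition).prod = w * simpleTransposition i) :
      permLength (w * simpleTransposition i) ≤ l.length := by
    rw [permLength_eq_card_inversions, ← h]
    exact card_inversions_prod_le l
  have hprod : (l.map simpleTransposition).prod * simpleTransposition i = w ↔
      (l.map simpleTransposition).prod = w * simpleTransposition i := by
    rw [← eq_mul_inv_iff_mul_eq, simpleTransposition_inv]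
  simp only [isReducedWord_iff, List.map_append, List.prod_append, List.map_singleton,
    List.prod_singleton, List.length_append, List.length_singleton, hprod]
  by_cases h : IsDescent w i
  · have := permLength_mul_simpleTransposition_of_isDescent h
    grind
  · have := permLength_mul_simpleTransposition h
    grind

theorem IsReducedWord.reverse (h : IsReducedWord w l) : IsReducedWord w⁻¹ l.reverse := by
  have hprod (l : List (Fin (r - 1))) :
      (l.reverse.map simpleTransposition).prod = (l.map simpleTransposition).prod⁻¹ := by
    simp [List.prod_inv_reverse, Function.comp_def]
  refine ⟨by rw [hprod, h.1], fun l' hl' => ?_⟩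
  simpa using h.2 l'.reverse (by rw [hprod, hl', inv_inv])

end SymmetricGroup

/-! ### Braid relations and Matsumoto's theorem -/

/-- The braid relations of type `A` for a finite sequence of elements of a monoid. -/
structure IsBraidFamily {n : ℕ} {M : Type*} [Monoid M] (f : Fin n → M) : Prop where
  braid : ∀ i j : Fin n, (i : ℕ) + 1 = j → f i * f j * f i = f j * f i * f j
  commute : ∀ i j : Fin n, (i : ℕ) + 2 ≤ j → Commute (f i) (f j)

namespace IsBraidFamily

variable {n : ℕ} {M N R : Type*} [Monoid M] [Monoid N] [Ring R] {f : Fin n → M} {g : Fin n → R}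

theorem map {F : Type*} [FunLike F M N] [MonoidHomClass F M N] (hf : IsBraidFamily f) (φ : F) :
    IsBraidFamily (φ ∘ f) where
  braid i j h := by simp only [Function.comp_apply, ← map_mul, hf.braid i j h]
  commute i j h := (hf.commute i j h).map φ

theorem op (hf : IsBraidFamily f) : IsBraidFamily (MulOpposite.op ∘ f) where
  braid i j h := by
    simp only [Function.comp_apply, ← MulOpposite.op_mul, ← mul_assoc, hf.braid i j h]
  commute i j h := (hf.commute i j h).op

theorem comp_rev (hf : IsBraidFamily f) : IsBraidFamily (f ∘ Fin.rev) where
  braid i j h := (hf.braid j.rev i.rev (by simp only [Fin.val_rev]; omega)).symm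
  commute i j h := (hf.commute j.rev i.rev (by simp only [Fin.val_rev]; omega)).symm

theorem neg (hg : IsBraidFamily g) : IsBraidFamily (-g) where
  braid i j h := by simp only [Pi.neg_apply, mul_neg, neg_mul, neg_neg, hg.braid i j h]
  commute i j h := (hg.commute i j h).neg_left.neg_right

theorem one_sub (hg : IsBraidFamily g) (hidem : ∀ i, IsIdempotentElem (g i)) :
    IsBraidFamily (1 - g) where
  braid i j h := by
    have expand {a b : R} (ha : IsIdempotentElem a) :
        (1 - a) * (1 - b) * (1 - a) = 1 - a - b + a * b + b * a - a * b * a := by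
      have : (1 - a) * (1 - b) * (1 - a) =
          1 - a - b + a * b + b * a - a * b * a + (a * a - a) := by noncomm_ring
      rw [this, ha.eq, sub_self, add_zero]
    simp only [Pi.sub_apply, Pi.one_apply]
    rw [expand (hidem i), expand (hidem j), hg.braid i j h]
    abel
  commute i j h :=
    ((Commute.one_left _).sub_left ((Commute.one_right _).sub_right (hg.commute i j h)))

end IsBraidFamily

section Matsumoto

variable {r : ℕ} {w : Perm (Fin r)} {i j : Fin (r - 1)} {l l' : List (Fin (r - 1))}
  {M N : Type*} [Monoid M] [Monoid N] {f : Fin (r - 1) → M}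

theorem simpleTransposition_lo_of_ne (h : (j : ℕ) ≠ i) (h' : (j : ℕ) ≠ i + 1) :
    simpleTransposition i (lo j) = lo j :=
  simpleTransposition_of_ne (by simpa [Fin.ext_iff]) (by simpa [Fin.ext_iff])

theorem simpleTransposition_hi_of_ne (h : (j : ℕ) ≠ i) (h' : (j : ℕ) + 1 ≠ i) :
    simpleTransposition i (hi j) = hi j :=
  simpleTransposition_of_ne (by simpa [Fin.ext_iff]) (by simpa [Fin.ext_iff])

theorem isBraidFamily_simpleTransposition :
    IsBraidFamily (simpleTransposition : Fin (r - 1) → Perm (Fin r)) where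
  braid i j h := by
    calc simpleTransposition i * simpleTransposition j * simpleTransposition i
        = Equiv.swap (lo i) (hi j) := by
          rw [simpleTransposition_eq_swap j, Equiv.mul_swap_eq_swap_mul, lo_eq_hi_of_succ h,
            simpleTransposition_hi, simpleTransposition_hi_of_ne (by omega) (by omega),
            mul_simpleTransposition_mul_self]
      _ = simpleTransposition j * simpleTransposition i * simpleTransposition j := by
          rw [simpleTransposition_eq_swap i, Equiv.mul_swap_eq_swap_mul, ← lo_eq_hi_of_succ h,
            simpleTransposition_lo, simpleTransposition_lo_of_ne (by omega) (by omega),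
            mul_simpleTransposition_mul_self]
  commute i j h := by
    rw [commute_iff_eq, simpleTransposition_eq_swap j, Equiv.mul_swap_eq_swap_mul,
      simpleTransposition_lo_of_ne (by omega) (by omega),
      simpleTransposition_hi_of_ne (by omega) (by omega)]

theorem isDescent_mul_simpleTransposition_of_add_two_le (h : (i : ℕ) + 2 ≤ j ∨ (j : ℕ) + 2 ≤ i) :
    IsDescent (w * simpleTransposition i) j ↔ IsDescent w j := by
  rw [IsDescent, Equiv.Perm.mul_apply, Equiv.Perm.mul_apply,
    simpleTransposition_lo_of_ne (by omega) (by omega),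
    simpleTransposition_hi_of_ne (by omega) (by omega), IsDescent]

theorem isDescent_mul_simpleTransposition_succ (h : (i : ℕ) + 1 = j) :
    IsDescent (w * simpleTransposition i) j ↔ w (hi j) < w (lo i) := by
  rw [IsDescent, Equiv.Perm.mul_apply, Equiv.Perm.mul_apply, lo_eq_hi_of_succ h,
    simpleTransposition_hi, simpleTransposition_hi_of_ne (by omega) (by omega)]

theorem isDescent_mul_simpleTransposition_pred (h : (i : ℕ) + 1 = j) :
    IsDescent (w * simpleTransposition j) i ↔ w (hi j) < w (lo i) := by
  rw [IsDescent, Equiv.Perm.mul_apply, Equiv.Perm.mul_apply, ← lo_eq_hi_of_succ h,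
    simpleTransposition_lo, simpleTransposition_lo_of_ne (by omega) (by omega)]

theorem isDescent_mul_mul_simpleTransposition_pred (h : (i : ℕ) + 1 = j) :
    IsDescent (w * simpleTransposition i * simpleTransposition j) i ↔ IsDescent w j := by
  rw [isDescent_mul_simpleTransposition_pred h, Equiv.Perm.mul_apply, Equiv.Perm.mul_apply,
    simpleTransposition_lo, simpleTransposition_hi_of_ne (by omega) (by omega), IsDescent,
    lo_eq_hi_of_succ h]

theorem isDescent_mul_mul_simpleTransposition_succ (h : (i : ℕ) + 1 = j) :
    IsDescent (w * simpleTransposition j * simpleTransposition i) j ↔ IsDescent w i := by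
  rw [isDescent_mul_simpleTransposition_succ h, Equiv.Perm.mul_apply, Equiv.Perm.mul_apply,
    simpleTransposition_hi, simpleTransposition_lo_of_ne (by omega) (by omega), IsDescent,
    lo_eq_hi_of_succ h]

theorem exists_isReducedWord_of_add_two_le (hf : IsBraidFamily f) (h : (i : ℕ) + 2 ≤ j)
    (hi : IsDescent w i) (hj : IsDescent w j) :
    ∃ l l' : List (Fin (r - 1)), IsReducedWord (w * simpleTransposition i) l ∧
      IsReducedWord (w * simpleTransposition j) l' ∧
      (l.map f).prod * f i = (l'.map f).prod * f j := by
  obtain ⟨m, hm⟩ := exists_reducedWord (w * simpleTransposition i * simpleTransposition j)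
  refine ⟨m ++ [j], m ++ [i], isReducedWord_append_singleton.mpr
    ⟨(isDescent_mul_simpleTransposition_of_add_two_le (.inl h)).mpr hj, hm⟩,
    isReducedWord_append_singleton.mpr
    ⟨(isDescent_mul_simpleTransposition_of_add_two_le (.inr h)).mpr hi, ?_⟩, ?_⟩
  · rwa [mul_assoc, ← (isBraidFamily_simpleTransposition.commute i j h).eq, ← mul_assoc]
  · simp [mul_assoc, (hf.commute i j h).eq]

theorem exists_isReducedWord_of_succ (hf : IsBraidFamily f) (h : (i : ℕ) + 1 = j)
    (hi : IsDescent w i) (hj : IsDescent w j) :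
    ∃ l l' : List (Fin (r - 1)), IsReducedWord (w * simpleTransposition i) l ∧
      IsReducedWord (w * simpleTransposition j) l' ∧
      (l.map f).prod * f i = (l'.map f).prod * f j := by
  obtain ⟨m, hm⟩ := exists_reducedWord
    (w * simpleTransposition i * simpleTransposition j * simpleTransposition i)
  have hlt : w (ZeroHecke.hi j) < w (lo i) := by
    have hj' := hj
    rw [IsDescent, lo_eq_hi_of_succ h] at hj'
    exact hj'.trans hi
  refine ⟨m ++ [i] ++ [j], m ++ [j] ++ [i], ?_, ?_, ?_⟩
  · rw [isReducedWord_append_singleton, isReducedWord_append_singleton]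
    exact ⟨(isDescent_mul_simpleTransposition_succ h).mpr hlt,
      (isDescent_mul_mul_simpleTransposition_pred h).mpr hj, hm⟩
  · rw [isReducedWord_append_singleton, isReducedWord_append_singleton]
    refine ⟨(isDescent_mul_simpleTransposition_pred h).mpr hlt,
      (isDescent_mul_mul_simpleTransposition_succ h).mpr hi, ?_⟩
    simpa only [mul_assoc, ← isBraidFamily_simpleTransposition.braid i j h] using hm
  · have hbraid := hf.braid i j h
    simp only [mul_assoc] at hbraid
    simp [mul_assoc, hbraid]

theorem exists_isReducedWord_of_isDescent (hf : IsBraidFamily f)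
    (hi : IsDescent w i) (hj : IsDescent w j) :
    ∃ l l' : List (Fin (r - 1)), IsReducedWord (w * simpleTransposition i) l ∧
      IsReducedWord (w * simpleTransposition j) l' ∧
      (l.map f).prod * f i = (l'.map f).prod * f j := by
  wlog hij : i ≤ j generalizing i j
  · obtain ⟨l, l', hl, hl', h⟩ := this hj hi (le_of_not_ge hij)
    exact ⟨l', l, hl', hl, h.symm⟩
  rcases hij.eq_or_lt with rfl | hlt
  · obtain ⟨l, hl⟩ := exists_reducedWord (w * simpleTransposition i)
    exact ⟨l, l, hl, hl, rfl⟩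
  rcases (Nat.succ_le_of_lt (Fin.lt_def.mp hlt)).eq_or_lt with h | h
  · exact exists_isReducedWord_of_succ hf h hi hj
  · exact exists_isReducedWord_of_add_two_le hf h hi hj

/-- Matsumoto's theorem in type `A`. -/
theorem IsReducedWord.prod_map_eq (hf : IsBraidFamily f) (hl : IsReducedWord w l)
    (hl' : IsReducedWord w l') : (l.map f).prod = (l'.map f).prod := by
  have hlength : l.length = l'.length := le_antisymm (hl.2 l' hl'.1) (hl'.2 l hl.1)
  induction hn : l.length generalizing w l l' with
  | zero =>
    rw [List.length_eq_zero_iff.mp hn, List.length_eq_zero_iff.mp (hlength.symm.trans hn)]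
  | succ n ih =>
    obtain ⟨m, i, rfl⟩ := (List.eq_nil_or_concat' l).resolve_left (by rintro rfl; simp at hn)
    obtain ⟨m', i', rfl⟩ :=
      (List.eq_nil_or_concat' l').resolve_left (by rintro rfl; simp at hlength)
    obtain ⟨hi, hm⟩ := isReducedWord_append_singleton.mp hl
    obtain ⟨hi', hm'⟩ := isReducedWord_append_singleton.mp hl'
    obtain ⟨k, k', hk, hk', hkk'⟩ := exists_isReducedWord_of_isDescent hf hi hi'
    have hmn : m.length = n := by simpa using hn
    have hmn' : m'.length = n := by simpa [hmn] using hlength.symm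
    have hmk : (m.map f).prod = (k.map f).prod :=
      ih hm hk (le_antisymm (hm.2 k hk.1) (hk.2 m hm.1)) hmn
    have hmk' : (m'.map f).prod = (k'.map f).prod :=
      ih hm' hk' (le_antisymm (hm'.2 k' hk'.1) (hk'.2 m' hm'.1)) hmn'
    simp [hmk, hmk', hkk']

/-- The product of a braid family along a reduced word of `w`. -/
def permProd (f : Fin (r - 1) → M) (w : Perm (Fin r)) : M :=
  ((reducedWord w).map f).prod

theorem IsReducedWord.permProd_eq (hf : IsBraidFamily f) (hl : IsReducedWord w l) :
    permProd f w = (l.map f).prod :=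
  (isReducedWord_reducedWord w).prod_map_eq hf hl

theorem permProd_one (f : Fin (r - 1) → M) : permProd f 1 = 1 := by
  have hnil : reducedWord (1 : Perm (Fin r)) = [] :=
    List.length_eq_zero_iff.mp (Nat.le_zero.mp ((isReducedWord_reducedWord 1).2 [] rfl))
  rw [permProd, hnil, List.map_nil, List.prod_nil]

theorem permProd_of_isDescent (hf : IsBraidFamily f) (h : IsDescent w i) :
    permProd f w = permProd f (w * simpleTransposition i) * f i := by
  rw [(isReducedWord_append_singleton.mpr ⟨h, isReducedWord_reducedWord _⟩).permProd_eq hf]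
  simp [permProd]

theorem map_permProd {F : Type*} [FunLike F M N] [MonoidHomClass F M N] (φ : F)
    (f : Fin (r - 1) → M) (w : Perm (Fin r)) :
    φ (permProd f w) = permProd (φ ∘ f) w := by
  rw [permProd, permProd, map_list_prod, List.map_map]

theorem permProd_op (hf : IsBraidFamily f) (w : Perm (Fin r)) :
    permProd (MulOpposite.op ∘ f) w = MulOpposite.op (permProd f w⁻¹) := by
  rw [(isReducedWord_reducedWord w).reverse.permProd_eq hf, MulOpposite.op_list_prod, permProd]
  simp [Function.comp_def]

theorem permProd_comp_rev (hf : IsBraidFamily f) (w : Perm (Fin r)) :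
    permProd (f ∘ Fin.rev) w = permProd f (Fin.revPerm * w * Fin.revPerm) := by
  induction w using descent_induction with
  | one => rw [mul_one, revPerm_mul_revPerm, permProd_one, permProd_one]
  | step w i h ih =>
    have hrev : IsDescent (Fin.revPerm * w * Fin.revPerm) i.rev := by
      rw [isDescent_mul_revPerm, Fin.rev_rev, isDescent_revPerm_mul, not_not]
      exact h
    have hconj : Fin.revPerm * w * Fin.revPerm * simpleTransposition i.rev =
        Fin.revPerm * (w * simpleTransposition i) * Fin.revPerm := by
      rw [← revPerm_mul_simpleTransposition_mul_revPerm]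
      simp only [mul_assoc, ← mul_assoc Fin.revPerm Fin.revPerm, revPerm_mul_revPerm, one_mul]
    rw [permProd_of_isDescent hf.comp_rev h, permProd_of_isDescent hf hrev, hconj, ih,
      Function.comp_apply]

end Matsumoto

/-! ### Demazure products and longest elements -/

section Demazure

variable {r : ℕ} {w u : Perm (Fin r)} {i j : Fin (r - 1)} {S T : Finset (Fin (r - 1))}
  {M : Type*} [Monoid M] {f : Fin (r - 1) → M}

/-- The Demazure product of `w` with a simple transposition, which never decreases the length. -/
def demazureMul (w : Perm (Fin r)) (i : Fin (r - 1)) : Perm (Fin r) :=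
  if IsDescent w i then w else w * simpleTransposition i

theorem demazureMul_of_isDescent (h : IsDescent w i) : demazureMul w i = w :=
  if_pos h

theorem demazureMul_of_not_isDescent (h : ¬ IsDescent w i) :
    demazureMul w i = w * simpleTransposition i :=
  if_neg h

theorem isDescent_demazureMul (w : Perm (Fin r)) (i : Fin (r - 1)) :
    IsDescent (demazureMul w i) i := by
  by_cases h : IsDescent w i
  · rwa [demazureMul_of_isDescent h]
  · rwa [demazureMul_of_not_isDescent h, isDescent_mul_simpleTransposition_self]

theorem demazureMul_mul_simpleTransposition (h : IsDescent w i) :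
    demazureMul (w * simpleTransposition i) i = w := by
  rw [demazureMul_of_not_isDescent (isDescent_mul_simpleTransposition_self.not.mpr (not_not.mpr h)),
    mul_simpleTransposition_mul_self]

theorem demazureMul_eq_iff :
    demazureMul u i = w ↔ IsDescent w i ∧ (u = w ∨ u = w * simpleTransposition i) := by
  constructor
  · rintro rfl
    refine ⟨isDescent_demazureMul u i, ?_⟩
    by_cases h : IsDescent u i
    · exact .inl (demazureMul_of_isDescent h).symm
    · rw [demazureMul_of_not_isDescent h, mul_simpleTransposition_mul_self]
      exact .inr rfl
  · rintro ⟨h, rfl | rfl⟩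
    · exact demazureMul_of_isDescent h
    · exact demazureMul_mul_simpleTransposition h

theorem permProd_mul (hf : IsBraidFamily f) (hidem : ∀ i, IsIdempotentElem (f i))
    (w : Perm (Fin r)) (i : Fin (r - 1)) :
    permProd f w * f i = permProd f (demazureMul w i) := by
  by_cases h : IsDescent w i
  · rw [demazureMul_of_isDescent h, permProd_of_isDescent hf h, mul_assoc, (hidem i).eq]
  · rw [demazureMul_of_not_isDescent h,
      permProd_of_isDescent hf (isDescent_mul_simpleTransposition_self.mpr h),
      mul_simpleTransposition_mul_self]

theorem permProd_mul_of_isDescent (hf : IsBraidFamily f) (hidem : ∀ i, IsIdempotentElem (f i))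
    (h : IsDescent w i) : permProd f w * f i = permProd f w := by
  rw [permProd_mul hf hidem, demazureMul_of_isDescent h]

theorem mul_permProd_of_isDescent_inv (hf : IsBraidFamily f)
    (hidem : ∀ i, IsIdempotentElem (f i)) (h : IsDescent w⁻¹ i) :
    f i * permProd f w = permProd f w := by
  have hop := permProd_mul_of_isDescent hf.op (fun i => congrArg MulOpposite.op (hidem i).eq) h
  rw [permProd_op hf, inv_inv] at hop
  exact MulOpposite.op_injective hop

theorem demazureMul_comm (h : (i : ℕ) + 2 ≤ j) (w : Perm (Fin r)) :
    demazureMul (demazureMul w i) j = demazureMul (demazureMul w j) i := by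
  have hcomm := (isBraidFamily_simpleTransposition.commute i j h).eq
  simp only [demazureMul]
  by_cases hi : IsDescent w i <;> by_cases hj : IsDescent w j <;>
    simp [hi, hj, isDescent_mul_simpleTransposition_of_add_two_le (.inl h),
      isDescent_mul_simpleTransposition_of_add_two_le (.inr h), mul_assoc, hcomm]

theorem demazureMul_braid (h : (i : ℕ) + 1 = j) (w : Perm (Fin r)) :
    demazureMul (demazureMul (demazureMul w i) j) i =
      demazureMul (demazureMul (demazureMul w j) i) j := by
  have hbraid := congrArg (w * ·) (isBraidFamily_simpleTransposition.braid i j h)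
  simp only [← mul_assoc] at hbraid
  have hpred : IsDescent (w * simpleTransposition i) j ↔ IsDescent (w * simpleTransposition j) i :=
    (isDescent_mul_simpleTransposition_succ h).trans
      (isDescent_mul_simpleTransposition_pred h).symm
  have htrans : IsDescent w i → IsDescent w j → IsDescent (w * simpleTransposition j) i := by
    rw [isDescent_mul_simpleTransposition_pred h, IsDescent, IsDescent, lo_eq_hi_of_succ h]
    exact fun hi hj => hj.trans hi
  have htrans' : ¬ IsDescent w i → ¬ IsDescent w j → ¬ IsDescent (w * simpleTransposition j) i := by
    rw [isDescent_mul_simpleTransposition_pred h, not_isDescent_iff, not_isDescent_iff,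
      lo_eq_hi_of_succ h]
    exact fun hi hj => (hi.trans hj).not_gt
  simp only [demazureMul]
  by_cases hi : IsDescent w i <;> by_cases hj : IsDescent w j <;>
    by_cases hij : IsDescent (w * simpleTransposition j) i <;>
    simp_all [isDescent_mul_mul_simpleTransposition_succ h,
      isDescent_mul_mul_simpleTransposition_pred h, isDescent_mul_simpleTransposition_self]

/-- Demazure multiplication on the right by a simple transposition, as an element of the opposite
of the monoid of self-maps, so that products are read from left to right. -/
def demazureOp (i : Fin (r - 1)) : (Function.End (Perm (Fin r)))ᵐᵒᵖ :=
  MulOpposite.op fun w => demazureMul w i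

theorem isIdempotentElem_demazureOp (i : Fin (r - 1)) :
    IsIdempotentElem (demazureOp i : (Function.End (Perm (Fin r)))ᵐᵒᵖ) :=
  congrArg MulOpposite.op
    (funext fun w => demazureMul_of_isDescent (isDescent_demazureMul w i))

theorem isBraidFamily_demazureOp :
    IsBraidFamily (demazureOp : Fin (r - 1) → (Function.End (Perm (Fin r)))ᵐᵒᵖ) where
  braid _ _ h := congrArg MulOpposite.op (funext (demazureMul_braid h))
  commute _ _ h := congrArg MulOpposite.op (funext (demazureMul_comm h))

theorem permProd_demazureOp_one (w : Perm (Fin r)) : (permProd demazureOp w).unop 1 = w := by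
  induction w using descent_induction with
  | one => rw [permProd_one]; rfl
  | step w i h ih =>
    rw [permProd_of_isDescent isBraidFamily_demazureOp h]
    change demazureMul ((permProd demazureOp (w * simpleTransposition i)).unop 1) i = w
    rw [ih, demazureMul_mul_simpleTransposition h]

theorem permProd_demazureOp_injective :
    Function.Injective
      (permProd demazureOp : Perm (Fin r) → (Function.End (Perm (Fin r)))ᵐᵒᵖ) :=
  fun u w h => by rw [← permProd_demazureOp_one u, h, permProd_demazureOp_one w]

theorem apply_le_lo_iff_of_mem_parabolic (hw : w ∈ parabolic S) (hi : i ∉ S) (k : Fin r) :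
    w k ≤ lo i ↔ k ≤ lo i := by
  induction hw using Subgroup.closure_induction generalizing k with
  | mem x hx =>
    obtain ⟨j, hj, rfl⟩ := hx
    have hji : j ≠ i := fun e => hi (e ▸ hj)
    rw [simpleTransposition_eq_swap, Equiv.swap_apply_def]
    split_ifs <;> simp only [ne_eq, Fin.ext_iff, Fin.le_def, val_lo, val_hi] at * <;> omega
  | one => rfl
  | mul x y _ _ hx hy => rw [Equiv.Perm.mul_apply, hx, hy]
  | inv x _ hx => rw [← hx, ← Equiv.Perm.mul_apply, mul_inv_cancel, Equiv.Perm.one_apply]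

theorem mem_of_isDescent_of_mem_parabolic (hw : w ∈ parabolic S) (h : IsDescent w i) : i ∈ S := by
  by_contra hi
  have hlo := (apply_le_lo_iff_of_mem_parabolic hw hi (lo i)).mpr le_rfl
  exact (lo_lt_hi i).not_ge ((apply_le_lo_iff_of_mem_parabolic hw hi _).mp (h.le.trans hlo))

theorem permProd_induction_of_mem_parabolic (hf : IsBraidFamily f) {motive : M → Prop}
    (one : motive 1) (mul : ∀ x, motive x → ∀ i ∈ S, motive (x * f i)) (hw : w ∈ parabolic S) :
    motive (permProd f w) := by
  induction w using descent_induction with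
  | one => rwa [permProd_one]
  | step w i h ih =>
    have hi := mem_of_isDescent_of_mem_parabolic hw h
    rw [permProd_of_isDescent hf h]
    exact mul _ (ih (mul_mem hw (simpleTransposition_mem_parabolic hi))) i hi

theorem permLength_inv (w : Perm (Fin r)) : permLength w⁻¹ = permLength w := by
  rw [← (isReducedWord_iff.mp (isReducedWord_reducedWord w).reverse).2, List.length_reverse,
    permLength]

theorem isDescent_longest (hi : i ∈ S) : IsDescent (longest S) i := by
  by_contra h
  have hle := (longest_spec S).2 _
    (mul_mem (longest_spec S).1 (simpleTransposition_mem_parabolic hi))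
  rw [permLength_mul_simpleTransposition h] at hle
  omega

theorem isDescent_longest_inv (hi : i ∈ S) : IsDescent (longest S)⁻¹ i := by
  by_contra h
  have hle := (longest_spec S).2 _ (inv_mem
    (mul_mem (inv_mem (longest_spec S).1) (simpleTransposition_mem_parabolic hi)))
  rw [permLength_inv, permLength_mul_simpleTransposition h, permLength_inv] at hle
  omega

theorem eq_longest (hu : u ∈ parabolic S) (h : ∀ i ∈ S, IsDescent u i) : u = longest S := by
  have hbraid : IsBraidFamily (demazureOp (r := r)) := isBraidFamily_demazureOp
  have habsorb : permProd demazureOp u * permProd demazureOp (longest S) =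
      permProd demazureOp u :=
    permProd_induction_of_mem_parabolic hbraid (motive := (permProd demazureOp u * · = _))
      (mul_one _) (fun x hx i hi => by
        rw [← mul_assoc, hx,
          permProd_mul_of_isDescent hbraid isIdempotentElem_demazureOp (h i hi)])
      (longest_spec S).1
  have habsorb' : permProd demazureOp u * permProd demazureOp (longest S) =
      permProd demazureOp (longest S) :=
    permProd_induction_of_mem_parabolic hbraid (motive := (· * permProd demazureOp _ = _))
      (one_mul _) (fun x hx i hi => by
        rw [mul_assoc, mul_permProd_of_isDescent_inv hbraid isIdempotentElem_demazureOp
          (isDescent_longest_inv hi), hx])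
      hu
  exact permProd_demazureOp_injective (habsorb.symm.trans habsorb')

theorem longest_inv (S : Finset (Fin (r - 1))) : (longest S)⁻¹ = longest S :=
  eq_longest (inv_mem (longest_spec S).1) fun _ => isDescent_longest_inv

theorem revPerm_mul_longest_mul_revPerm (hST : ∀ i : Fin (r - 1), i.rev ∈ T ↔ i ∈ S) :
    Fin.revPerm * longest S * Fin.revPerm = longest T := by
  have hconj : permProd (simpleTransposition ∘ Fin.rev) (longest S) =
      Fin.revPerm * longest S * Fin.revPerm := by
    rw [permProd_comp_rev isBraidFamily_simpleTransposition]
    exact (isReducedWord_reducedWord _).1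
  refine eq_longest ?_ fun i hi => ?_
  · rw [← hconj]
    exact permProd_induction_of_mem_parabolic isBraidFamily_simpleTransposition.comp_rev
      (motive := (· ∈ parabolic T)) (one_mem _)
      (fun x hx i hi => mul_mem hx (simpleTransposition_mem_parabolic ((hST i).mpr hi)))
      (longest_spec S).1
  · rw [isDescent_mul_revPerm, isDescent_revPerm_mul, not_not]
    exact isDescent_longest ((hST i.rev).mp (by rwa [Fin.rev_rev]))

end Demazure

/-! ### The standard basis of the 0-Hecke algebra -/

section StandardBasis

variable {r : ℕ} {w v : Perm (Fin r)} {i j : Fin (r - 1)} {A : Type*} [Ring A] [Algebra ℂ A]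

-- Without this shortcut, negation on `Hecke r` is not found through the ring structure.
instance : Ring (Hecke r) := RingQuot.instRing (Rel r)

/-- The generator `-π̄_i`. Both `tau` and `pi = 1 - tau` are families of idempotents satisfying the
braid relations, so they play interchangeable roles. -/
def tau (i : Fin (r - 1)) : Hecke r := -opi i

theorem isIdempotentElem_tau (i : Fin (r - 1)) : IsIdempotentElem (tau i) := by
  have hquad := RingQuot.mkAlgHom_rel ℂ (Rel.quad i)
  rw [map_mul, map_neg] at hquad
  rw [IsIdempotentElem, tau, neg_mul_neg]
  exact hquad

theorem isBraidFamily_opi : IsBraidFamily (opi : Fin (r - 1) → Hecke r) where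
  braid i j h := by
    have hbraid := RingQuot.mkAlgHom_rel ℂ (Rel.braid i j h)
    simp only [map_mul] at hbraid
    exact hbraid
  commute i j h := by
    have hcomm := RingQuot.mkAlgHom_rel ℂ (Rel.comm i j (.inl h))
    simp only [map_mul] at hcomm
    exact hcomm

theorem isBraidFamily_tau : IsBraidFamily (tau : Fin (r - 1) → Hecke r) :=
  isBraidFamily_opi.neg

theorem pi_eq_one_sub_tau : (pi : Fin (r - 1) → Hecke r) = 1 - tau := by
  ext i
  simp [pi, tau, add_comm]

theorem isIdempotentElem_pi (i : Fin (r - 1)) : IsIdempotentElem (pi i) := by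
  rw [pi_eq_one_sub_tau]
  exact (isIdempotentElem_tau i).one_sub

theorem isBraidFamily_pi : IsBraidFamily (pi : Fin (r - 1) → Hecke r) := by
  rw [pi_eq_one_sub_tau]
  exact isBraidFamily_tau.one_sub isIdempotentElem_tau

theorem tau_mul_pi (i : Fin (r - 1)) : tau i * pi i = 0 := by
  rw [pi_eq_one_sub_tau]
  exact (isIdempotentElem_tau i).mul_one_sub_self

theorem opiPerm_eq_smul (w : Perm (Fin r)) :
    opiPerm w = (-1 : ℂˣ) ^ permLength w • permProd tau w := by
  have hword (l : List (Fin (r - 1))) :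
      (l.map opi).prod = (-1 : ℂˣ) ^ l.length • (l.map tau).prod := by
    induction l with
    | nil => simp
    | cons i l ih => simp [ih, tau, pow_succ, Units.smul_def]
  exact hword _

/-- The universal property of the 0-Hecke algebra. -/
def lift (f : Fin (r - 1) → A) (hidem : ∀ i, IsIdempotentElem (f i)) (hf : IsBraidFamily f) :
    Hecke r →ₐ[ℂ] A :=
  RingQuot.liftAlgHom ℂ ⟨FreeAlgebra.lift ℂ (-f), by
    rintro _ _ (i | ⟨i, j, h⟩ | ⟨i, j, h | h⟩)
    · simp [(hidem i).eq]
    · simpa using hf.neg.braid i j h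
    · simpa using (hf.commute i j h).eq
    · simpa using (hf.commute j i h).eq.symm⟩

@[simp] theorem lift_tau (f : Fin (r - 1) → A) (hidem : ∀ i, IsIdempotentElem (f i))
    (hf : IsBraidFamily f) (i : Fin (r - 1)) : lift f hidem hf (tau i) = f i := by
  rw [tau, map_neg, lift, opi, RingQuot.liftAlgHom_mkAlgHom_apply, FreeAlgebra.lift_ι_apply,
    Pi.neg_apply, neg_neg]

theorem adjoin_range_tau : Algebra.adjoin ℂ (Set.range (tau : Fin (r - 1) → Hecke r)) = ⊤ := by
  rw [eq_top_iff, ← (AlgHom.range_eq_top _).mpr (RingQuot.mkAlgHom_surjective ℂ (Rel r)),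
    ← Algebra.map_top, ← FreeAlgebra.adjoin_range_ι, AlgHom.map_adjoin, Algebra.adjoin_le_iff]
  rintro _ ⟨_, ⟨i, rfl⟩, rfl⟩
  simpa [tau, opi] using neg_mem (Algebra.subset_adjoin (R := ℂ) (Set.mem_range_self (f := tau) i))

theorem algHom_ext_tau {φ ψ : Hecke r →ₐ[ℂ] A} (h : ∀ i, φ (tau i) = ψ (tau i)) : φ = ψ :=
  AlgHom.ext_of_adjoin_eq_top adjoin_range_tau (by rintro _ ⟨i, rfl⟩; exact h i)

theorem span_range_permProd_tau :
    Submodule.span ℂ (Set.range (permProd tau : Perm (Fin r) → Hecke r)) = ⊤ := by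
  rw [eq_top_iff, ← Algebra.top_toSubmodule, ← adjoin_range_tau, Algebra.adjoin_eq_span]
  refine Submodule.span_mono fun x hx => ?_
  induction hx using Submonoid.closure_induction_right with
  | one => exact ⟨1, permProd_one tau⟩
  | mul_right x _ y hy ih =>
    obtain ⟨w, rfl⟩ := ih
    obtain ⟨i, rfl⟩ := hy
    exact ⟨_, (permProd_mul isBraidFamily_tau isIdempotentElem_tau w i).symm⟩

theorem linearIndependent_permProd_tau :
    LinearIndependent ℂ (permProd tau : Perm (Fin r) → Hecke r) := by
  let ι := MonoidAlgebra.of ℂ (Function.End (Perm (Fin r)))ᵐᵒᵖ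
  let φ : Hecke r →ₐ[ℂ] MonoidAlgebra ℂ (Function.End (Perm (Fin r)))ᵐᵒᵖ :=
    lift (ι ∘ demazureOp) (fun i => (isIdempotentElem_demazureOp i).map ι)
      (isBraidFamily_demazureOp.map ι)
  have hφ : φ ∘ permProd tau = MonoidAlgebra.basis _ ℂ ∘ permProd demazureOp := by
    funext w
    calc φ (permProd tau w) = permProd (φ ∘ tau) w := map_permProd φ tau w
      _ = permProd (ι ∘ demazureOp) w := by
        rw [show φ ∘ tau = ι ∘ demazureOp from funext fun i => lift_tau _ _ _ i]
      _ = ι (permProd demazureOp w) := (map_permProd ι demazureOp w).symm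
      _ = MonoidAlgebra.basis _ ℂ (permProd demazureOp w) := (MonoidAlgebra.basis_apply ..).symm
  refine LinearIndependent.of_comp φ.toLinearMap ?_
  change LinearIndependent ℂ (φ ∘ permProd tau)
  rw [hφ]
  exact (MonoidAlgebra.basis _ ℂ).linearIndependent.comp _ permProd_demazureOp_injective

/-- The basis `w ↦ permProd tau w` of the 0-Hecke algebra. -/
def stdBasis (r : ℕ) : Module.Basis (Perm (Fin r)) ℂ (Hecke r) :=
  .mk linearIndependent_permProd_tau span_range_permProd_tau.ge

theorem stdBasis_apply (w : Perm (Fin r)) : stdBasis r w = permProd tau w :=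
  Module.Basis.mk_apply _ _ w

instance : Module.Finite ℂ (Hecke r) := .of_basis (stdBasis r)

/-- The coefficient of `permProd tau v` in the standard basis. -/
def coeff (v : Perm (Fin r)) : Hecke r →ₗ[ℂ] ℂ := (stdBasis r).coord v

theorem coeff_permProd_tau (v w : Perm (Fin r)) :
    coeff v (permProd tau w) = if w = v then 1 else 0 := by
  rw [← stdBasis_apply, coeff, Module.Basis.coord_apply, Module.Basis.repr_self,
    Finsupp.single_apply]

theorem ext_coeff {h k : Hecke r} (hhk : ∀ v, coeff v h = coeff v k) : h = k :=
  (stdBasis r).ext_elem hhk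

theorem sum_coeff_smul_permProd_tau (h : Hecke r) :
    ∑ w, coeff w h • permProd tau w = h := by
  simpa only [stdBasis_apply, coeff, Module.Basis.coord_apply] using (stdBasis r).sum_repr h

theorem coeff_mul_tau (v : Perm (Fin r)) (h : Hecke r) (i : Fin (r - 1)) :
    coeff v (h * tau i) =
      if IsDescent v i then coeff v h + coeff (v * simpleTransposition i) h else 0 := by
  have hne := mul_simpleTransposition_ne v i
  have hbasis : coeff v ∘ₗ LinearMap.mulRight ℂ (tau i) =
      if IsDescent v i then coeff v + coeff (v * simpleTransposition i) else 0 := by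
    refine (stdBasis r).ext fun w => ?_
    rw [stdBasis_apply, LinearMap.comp_apply, LinearMap.mulRight_apply,
      permProd_mul isBraidFamily_tau isIdempotentElem_tau, coeff_permProd_tau]
    simp only [demazureMul_eq_iff]
    by_cases hv : IsDescent v i
    · rw [if_pos hv, LinearMap.add_apply, coeff_permProd_tau, coeff_permProd_tau]
      grind
    · simp [hv]
  have := LinearMap.congr_fun hbasis h
  split_ifs at this ⊢ <;> exact this

theorem coeff_mul_pi (v : Perm (Fin r)) (h : Hecke r) (i : Fin (r - 1)) :
    coeff v (h * pi i) =
      if IsDescent v i then -coeff (v * simpleTransposition i) h else coeff v h := by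
  rw [pi_eq_one_sub_tau, Pi.sub_apply, Pi.one_apply, mul_sub, mul_one, map_sub, coeff_mul_tau]
  split_ifs <;> ring

end StandardBasis

/-! ### Symmetries of the 0-Hecke algebra -/

section Symmetries

open MulOpposite (op)

variable {r : ℕ} {S T : Finset (Fin (r - 1))}

/-- The anti-automorphism of the 0-Hecke algebra that fixes the generators. -/
def transpose (r : ℕ) : Hecke r ≃ₐ[ℂ] (Hecke r)ᵐᵒᵖ :=
  let φ : Hecke r →ₐ[ℂ] (Hecke r)ᵐᵒᵖ :=
    lift (op ∘ tau) (fun i => congrArg op (isIdempotentElem_tau i).eq) isBraidFamily_tau.op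
  have hgen (i : Fin (r - 1)) : φ (tau i) = op (tau i) := lift_tau _ _ _ i
  have hφ : (AlgHom.opComm φ).comp φ = .id ℂ (Hecke r) :=
    algHom_ext_tau fun i => by simp [AlgHom.opComm_apply_apply, hgen]
  .ofAlgHom φ (AlgHom.opComm φ)
    (AlgHom.ext fun h => MulOpposite.unop_injective (AlgHom.congr_fun hφ h.unop)) hφ

theorem transpose_tau (i : Fin (r - 1)) : transpose r (tau i) = op (tau i) :=
  lift_tau _ _ _ i

theorem transpose_pi (i : Fin (r - 1)) : transpose r (pi i) = op (pi i) := by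
  rw [pi_eq_one_sub_tau, Pi.sub_apply, Pi.one_apply, map_sub, map_one, transpose_tau,
    MulOpposite.op_sub, MulOpposite.op_one]

theorem coeff_unop_transpose (v : Perm (Fin r)) (h : Hecke r) :
    coeff v (transpose r h).unop = coeff v⁻¹ h := by
  have hbasis : coeff v ∘ₗ (MulOpposite.opLinearEquiv ℂ).symm.toLinearMap ∘ₗ
      (transpose r).toLinearMap = coeff v⁻¹ := by
    refine (stdBasis r).ext fun w => ?_
    change coeff v (transpose r (stdBasis r w)).unop = _
    rw [stdBasis_apply, map_permProd, show transpose r ∘ tau = op ∘ tau from funext transpose_tau,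
      permProd_op isBraidFamily_tau, MulOpposite.unop_op, coeff_permProd_tau, coeff_permProd_tau]
    simp only [inv_eq_iff_eq_inv]
  exact LinearMap.congr_fun hbasis h

theorem coeff_tau_mul (v : Perm (Fin r)) (i : Fin (r - 1)) (h : Hecke r) :
    coeff v (tau i * h) =
      if IsDescent v⁻¹ i then coeff v h + coeff (simpleTransposition i * v) h else 0 := by
  have htranspose : coeff v (tau i * h) = coeff v⁻¹ ((transpose r h).unop * tau i) := by
    rw [← inv_inv v, ← coeff_unop_transpose, map_mul, transpose_tau, MulOpposite.unop_mul,
      MulOpposite.unop_op, inv_inv]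
  rw [htranspose, coeff_mul_tau, coeff_unop_transpose, coeff_unop_transpose, inv_inv, mul_inv_rev,
    inv_inv, simpleTransposition_inv]

/-- The automorphism of the 0-Hecke algebra that exchanges `tau i` and `pi i`. -/
def complAut (r : ℕ) : Hecke r ≃ₐ[ℂ] Hecke r :=
  let φ : Hecke r →ₐ[ℂ] Hecke r := lift pi isIdempotentElem_pi isBraidFamily_pi
  have hφ : φ.comp φ = .id ℂ (Hecke r) := algHom_ext_tau fun i => by
    simp [φ, pi_eq_one_sub_tau]
  .ofAlgHom φ φ hφ hφ

theorem complAut_tau (i : Fin (r - 1)) : complAut r (tau i) = pi i :=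
  lift_tau _ _ _ i

theorem complAut_pi (i : Fin (r - 1)) : complAut r (pi i) = tau i := by
  rw [← complAut_tau]
  exact (complAut r).left_inv _

/-- The automorphism of the 0-Hecke algebra that reverses the Dynkin diagram. -/
def revAut (r : ℕ) : Hecke r ≃ₐ[ℂ] Hecke r :=
  let φ : Hecke r →ₐ[ℂ] Hecke r :=
    lift (tau ∘ Fin.rev) (fun i => isIdempotentElem_tau i.rev) isBraidFamily_tau.comp_rev
  have hφ : φ.comp φ = .id ℂ (Hecke r) := algHom_ext_tau fun i => by simp [φ]
  .ofAlgHom φ φ hφ hφ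

theorem revAut_tau (i : Fin (r - 1)) : revAut r (tau i) = tau i.rev :=
  lift_tau _ _ _ i

theorem revAut_pi (i : Fin (r - 1)) : revAut r (pi i) = pi i.rev := by
  simp only [pi_eq_one_sub_tau, Pi.sub_apply, Pi.one_apply, map_sub, map_one, revAut_tau]

/-- A generator of the projective indecomposable module of the composition with partial sums `S`. -/
def gen (S : Finset (Fin (r - 1))) : Hecke r :=
  permProd tau (longest S) * permProd pi (longest Sᶜ)

/-- The element `gen S` with its two factors exchanged. -/
def swapGen (S : Finset (Fin (r - 1))) : Hecke r :=
  permProd pi (longest Sᶜ) * permProd tau (longest S)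

theorem transpose_gen (S : Finset (Fin (r - 1))) : transpose r (gen S) = op (swapGen S) := by
  rw [gen, map_mul, map_permProd, map_permProd,
    show transpose r ∘ tau = op ∘ tau from funext transpose_tau,
    show transpose r ∘ pi = op ∘ pi from funext transpose_pi,
    permProd_op isBraidFamily_tau, permProd_op isBraidFamily_pi, longest_inv, longest_inv, swapGen,
    MulOpposite.op_mul]

theorem complAut_gen_compl (S : Finset (Fin (r - 1))) : complAut r (gen Sᶜ) = swapGen S := by
  rw [gen, map_mul, map_permProd, map_permProd, compl_compl, swapGen,
    show complAut r ∘ tau = pi from funext complAut_tau,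
    show complAut r ∘ pi = tau from funext complAut_pi]

theorem revAut_gen (hST : ∀ i : Fin (r - 1), i.rev ∈ T ↔ i ∈ S) : revAut r (gen S) = gen T := by
  have hST' (i : Fin (r - 1)) : i.rev ∈ Tᶜ ↔ i ∈ Sᶜ := by simp [hST]
  rw [gen, map_mul, map_permProd, map_permProd,
    show revAut r ∘ tau = tau ∘ Fin.rev from funext revAut_tau,
    show revAut r ∘ pi = pi ∘ Fin.rev from funext revAut_pi,
    permProd_comp_rev isBraidFamily_tau, permProd_comp_rev isBraidFamily_pi,
    revPerm_mul_longest_mul_revPerm hST, revPerm_mul_longest_mul_revPerm hST', gen]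

theorem projIndec_eq_span_gen (α : Composition r) :
    projIndec α = Submodule.span (Hecke r) {gen (setEquiv r α)} := by
  rw [projIndec, opiPerm_eq_smul, smul_mul_assoc, Submodule.span_singleton_group_smul_eq]
  rfl

end Symmetries

/-! ### Group invertibility of the generators -/

section GenGroupInvertible

variable {r n : ℕ} {S : Finset (Fin (r - 1))} {v w : Perm (Fin r)} {h m : Hecke r}
  {i : Fin (r - 1)}

/-- The span of the standard basis elements indexed by permutations of length at least `n`. -/
def lengthFiltration (r n : ℕ) : Submodule ℂ (Hecke r) where
  carrier := {h | ∀ u, permLength u < n → coeff u h = 0}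
  zero_mem' u _ := map_zero (coeff u)
  add_mem' hh hk u hu := by rw [map_add, hh u hu, hk u hu, add_zero]
  smul_mem' c h hh u hu := by rw [map_smul, hh u hu, smul_zero]

theorem permProd_tau_mem_lengthFiltration (hw : n ≤ permLength w) :
    permProd tau w ∈ lengthFiltration r n := fun u hu => by
  rw [coeff_permProd_tau, if_neg]
  rintro rfl
  omega

theorem mul_tau_mem_lengthFiltration (hh : h ∈ lengthFiltration r n) (i : Fin (r - 1)) :
    h * tau i ∈ lengthFiltration r n := fun u hu => by
  rw [coeff_mul_tau]
  split_ifs with hdesc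
  · have hlt := permLength_mul_simpleTransposition_of_isDescent hdesc
    rw [hh u hu, hh _ (by omega), add_zero]
  · rfl

theorem mul_pi_mem_lengthFiltration (hh : h ∈ lengthFiltration r n) (i : Fin (r - 1)) :
    h * pi i ∈ lengthFiltration r n := by
  rw [pi_eq_one_sub_tau, Pi.sub_apply, Pi.one_apply, mul_sub, mul_one]
  exact sub_mem hh (mul_tau_mem_lengthFiltration hh i)

theorem mul_permProd_pi_mem_lengthFiltration (hh : h ∈ lengthFiltration r n) (w : Perm (Fin r)) :
    h * permProd pi w ∈ lengthFiltration r n := by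
  induction w using descent_induction with
  | one => rwa [permProd_one, mul_one]
  | step w i hdesc ih =>
    rw [permProd_of_isDescent isBraidFamily_pi hdesc, ← mul_assoc]
    exact mul_pi_mem_lengthFiltration ih i

theorem coeff_mul_permProd_pi (hw : w ∈ parabolic S) (hv : ∀ i ∈ S, ¬ IsDescent v i)
    (h : Hecke r) : coeff v (h * permProd pi w) = coeff v h := by
  refine permProd_induction_of_mem_parabolic isBraidFamily_pi
    (motive := fun x => coeff v (h * x) = coeff v h) (by rw [mul_one]) (fun x hx i hi => ?_) hw
  rw [← mul_assoc, coeff_mul_pi, if_neg (hv i hi), hx]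

theorem coeff_mul_permProd_tau (hw : w ∈ parabolic S) (hv : ∀ i ∈ S, IsDescent v i)
    (hh : h ∈ lengthFiltration r (permLength v)) :
    coeff v (h * permProd tau w) = coeff v h := by
  refine (permProd_induction_of_mem_parabolic isBraidFamily_tau
    (motive := fun x => h * x ∈ lengthFiltration r (permLength v) ∧ coeff v (h * x) = coeff v h)
    (by rw [mul_one]; exact ⟨hh, rfl⟩) (fun x ⟨hmem, hx⟩ i hi => ?_) hw).2
  have hlt := permLength_mul_simpleTransposition_of_isDescent (hv i hi)
  rw [← mul_assoc, coeff_mul_tau, if_pos (hv i hi), hmem (v * simpleTransposition i) (by omega),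
    add_zero]
  exact ⟨mul_tau_mem_lengthFiltration hmem i, hx⟩

theorem tau_mul_permProd_pi_longest (hi : i ∈ S) : tau i * permProd pi (longest S) = 0 := by
  rw [← mul_permProd_of_isDescent_inv isBraidFamily_pi isIdempotentElem_pi
    (isDescent_longest_inv hi), ← mul_assoc, tau_mul_pi, zero_mul]

theorem mul_permProd_pi_longest_mem_lengthFiltration (hm : ∀ i ∈ S, m * tau i = m)
    (hcoeff : ∀ v, (∀ i, IsDescent v i ↔ i ∈ S) → permLength v < n → coeff v m = 0) :
    m * permProd pi (longest Sᶜ) ∈ lengthFiltration r n := by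
  rw [← sum_coeff_smul_permProd_tau m, Finset.sum_mul]
  refine Submodule.sum_mem _ fun w _ => ?_
  rw [smul_mul_assoc]
  by_cases hbig : ∃ i ∈ Sᶜ, IsDescent w i
  · obtain ⟨i, hi, hdesc⟩ := hbig
    rw [← permProd_mul_of_isDescent isBraidFamily_tau isIdempotentElem_tau hdesc, mul_assoc,
      tau_mul_permProd_pi_longest hi, mul_zero, smul_zero]
    exact zero_mem _
  by_cases hsmall : ∃ i ∈ S, ¬ IsDescent w i
  · obtain ⟨i, hi, hdesc⟩ := hsmall
    rw [← hm i hi, coeff_mul_tau, if_neg hdesc, zero_smul]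
    exact zero_mem _
  push Not at hbig hsmall
  rcases lt_or_ge (permLength w) n with hlt | hge
  · have hw (i : Fin (r - 1)) : IsDescent w i ↔ i ∈ S :=
      ⟨fun hdesc => by_contra fun hi => hbig i (Finset.mem_compl.mpr hi) hdesc, hsmall i⟩
    rw [hcoeff w hw hlt, zero_smul]
    exact zero_mem _
  · exact Submodule.smul_mem _ _
      (mul_permProd_pi_mem_lengthFiltration (permProd_tau_mem_lengthFiltration hge) _)

theorem mul_gen_eq_zero_of_mul_gen_mul_gen_eq_zero (hh : h * gen S * gen S = 0) :
    h * gen S = 0 := by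
  set m := h * permProd tau (longest S) with hm
  set x := m * permProd pi (longest Sᶜ)
  have hgen : h * gen S = x := by rw [gen, ← mul_assoc]
  have hfix (i : Fin (r - 1)) (hi : i ∈ S) : m * tau i = m := by
    rw [hm, mul_assoc, permProd_mul_of_isDescent isBraidFamily_tau isIdempotentElem_tau
      (isDescent_longest hi)]
  have hcoeff (v : Perm (Fin r)) (hv : ∀ i, IsDescent v i ↔ i ∈ S) : coeff v m = 0 := by
    induction hn : permLength v using Nat.strong_induction_on generalizing v with
    | _ n ih =>
    have hxmem : x ∈ lengthFiltration r (permLength v) :=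
      mul_permProd_pi_longest_mem_lengthFiltration hfix fun u hu hlt => ih _ (hn ▸ hlt) u hu rfl
    have hpi (y : Hecke r) : coeff v (y * permProd pi (longest Sᶜ)) = coeff v y :=
      coeff_mul_permProd_pi (longest_spec Sᶜ).1
        (fun i hi => (hv i).not.mpr (Finset.mem_compl.mp hi)) y
    calc coeff v m = coeff v x := (hpi m).symm
      _ = coeff v (x * permProd tau (longest S)) :=
        (coeff_mul_permProd_tau (longest_spec S).1 (fun i hi => (hv i).mpr hi) hxmem).symm
      _ = coeff v (h * gen S * gen S) := by rw [hgen, gen, ← mul_assoc, hpi]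
      _ = 0 := by rw [hh, map_zero]
  rw [hgen]
  refine ext_coeff fun v => ?_
  rw [map_zero]
  exact mul_permProd_pi_longest_mem_lengthFiltration (n := permLength v + 1) hfix
    (fun u hu _ => hcoeff u hu) v (Nat.lt_succ_self _)

theorem isGroupInvertible_gen (S : Finset (Fin (r - 1))) : IsGroupInvertible (gen S) :=
  isGroupInvertible_of_forall_mul_mul_eq_zero ℂ fun _ => mul_gen_eq_zero_of_mul_gen_mul_gen_eq_zero

theorem isGroupInvertible_swapGen (S : Finset (Fin (r - 1))) : IsGroupInvertible (swapGen S) := by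
  rw [← complAut_gen_compl]
  exact (isGroupInvertible_gen Sᶜ).map (complAut r)

end GenGroupInvertible

/-! ### The Frobenius form -/

section FrobeniusForm

variable {r : ℕ}

/-- The Frobenius form: the coefficient of the longest permutation. Its Nakayama automorphism is
`revAut r`. -/
def frobForm (r : ℕ) : Hecke r →ₗ[ℂ] ℂ := coeff Fin.revPerm

theorem frobForm_mul_tau_rev (h : Hecke r) (i : Fin (r - 1)) :
    frobForm r (h * tau i.rev) = frobForm r (tau i * h) := by
  have hconj : (Fin.revPerm : Perm (Fin r)) * simpleTransposition i.rev =
      simpleTransposition i * Fin.revPerm := by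
    rw [← revPerm_mul_simpleTransposition_mul_revPerm, ← mul_assoc, ← mul_assoc,
      revPerm_mul_revPerm, one_mul]
  have hinv : (Fin.revPerm : Perm (Fin r))⁻¹ = Fin.revPerm :=
    inv_eq_of_mul_eq_one_left revPerm_mul_revPerm
  rw [frobForm, coeff_mul_tau, if_pos (isDescent_revPerm _), hconj, coeff_tau_mul, hinv,
    if_pos (isDescent_revPerm _)]

theorem frobForm_mul (g h : Hecke r) : frobForm r (g * h) = frobForm r (h * revAut r g) := by
  have hg : g ∈ Algebra.adjoin ℂ (Set.range (tau : Fin (r - 1) → Hecke r)) :=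
    adjoin_range_tau ▸ Algebra.mem_top
  induction hg using Algebra.adjoin_induction generalizing h with
  | mem _ hx =>
    obtain ⟨i, rfl⟩ := hx
    rw [revAut_tau, frobForm_mul_tau_rev]
  | algebraMap c => rw [AlgEquiv.commutes, Algebra.commutes]
  | add x y _ _ hx hy => rw [add_mul, map_add, hx, hy, map_add, mul_add, map_add]
  | mul x y _ _ hx hy => rw [mul_assoc, hx, mul_assoc, hy, map_mul (revAut r), mul_assoc]

theorem exists_forall_frobForm_mul_eq_coeff (v : Perm (Fin r)) :
    ∃ k : Hecke r, ∀ h, frobForm r (h * k) = coeff v h := by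
  suffices ∀ u : Perm (Fin r), ∃ k : Hecke r, ∀ h, frobForm r (h * k) = coeff (Fin.revPerm * u) h by
    have hv : Fin.revPerm * (Fin.revPerm * v) = v := by
      rw [← mul_assoc, revPerm_mul_revPerm, one_mul]
    exact hv ▸ this (Fin.revPerm * v)
  intro u
  induction u using descent_induction with
  | one => exact ⟨1, fun h => by rw [mul_one, mul_one, frobForm]⟩
  | step w i hdesc ih =>
    obtain ⟨k, hk⟩ := ih
    refine ⟨-(pi i * k), fun h => ?_⟩
    have hrev : IsDescent (Fin.revPerm * (w * simpleTransposition i)) i := by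
      rw [isDescent_revPerm_mul, isDescent_mul_simpleTransposition_self, not_not]
      exact hdesc
    rw [mul_neg, map_neg, ← mul_assoc, hk, coeff_mul_pi, if_pos hrev, neg_neg, mul_assoc,
      mul_simpleTransposition_mul_self]

theorem eq_zero_of_forall_frobForm_mul_eq_zero {h : Hecke r} (hh : ∀ k, frobForm r (h * k) = 0) :
    h = 0 :=
  ext_coeff fun v => by
    obtain ⟨k, hk⟩ := exists_forall_frobForm_mul_eq_coeff v
    rw [← hk, hh, map_zero]

end FrobeniusForm

/-! ### Symmetries of the Cartan matrix -/

section CartanSymmetries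

variable {r : ℕ}

theorem cartan_eq_cornerRank (α β : Composition r) :
    cartan r α β = cornerRank ℂ (gen (setEquiv r α)) (gen (setEquiv r β)) := by
  simp only [cartan, Matrix.of_apply]
  rw! [projIndec_eq_span_gen, projIndec_eq_span_gen]
  exact finrank_hom_span_singleton (isGroupInvertible_gen _) _

theorem cornerRank_swapGen (S T : Finset (Fin (r - 1))) :
    cornerRank ℂ (swapGen S) (swapGen T) = cornerRank ℂ (gen S) (gen T) :=
  cornerRank_mul_swap (isGroupInvertible_swapGen S) (isGroupInvertible_swapGen T)
    (isGroupInvertible_gen S) (isGroupInvertible_gen T)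

theorem cartan_comm (α β : Composition r) : cartan r α β = cartan r β α := by
  rw [cartan_eq_cornerRank, cartan_eq_cornerRank, ← cornerRank_map (transpose r), transpose_gen,
    transpose_gen, cornerRank_op, cornerRank_swapGen]

theorem cartan_complement (α β : Composition r) :
    cartan r (complement α) (complement β) = cartan r α β := by
  rw [cartan_eq_cornerRank, cartan_eq_cornerRank, setEquiv_complement, setEquiv_complement,
    ← cornerRank_map (complAut r), complAut_gen_compl, complAut_gen_compl, cornerRank_swapGen]

theorem cartan_reverse_right (α β : Composition r) : cartan r β α.reverse = cartan r α β := by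
  rw [cartan_eq_cornerRank, cartan_eq_cornerRank, ← revAut_gen (rev_mem_setEquiv_reverse α),
    ← cornerRank_eq_of_form (frobForm r) (revAut r) frobForm_mul
      fun _ => eq_zero_of_forall_frobForm_mul_eq_zero]

/-- The permutations of the set of pairs of compositions that preserve the Cartan matrix. -/
def cartanSymmetries (r : ℕ) : Subgroup (Perm (Composition r × Composition r)) where
  carrier := {σ | ∀ p, cartan r (σ p).1 (σ p).2 = cartan r p.1 p.2}
  one_mem' _ := rfl
  mul_mem' hσ hτ p := (hσ _).trans (hτ p)
  inv_mem' {σ} hσ p := by rw [← hσ, Equiv.Perm.inv_def, Equiv.apply_symm_apply]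

theorem ex_mem_cartanSymmetries : ex r ∈ cartanSymmetries r :=
  fun p => cartan_comm p.2 p.1

theorem compl_mem_cartanSymmetries : compl r ∈ cartanSymmetries r :=
  fun p => cartan_complement p.1 p.2

theorem eta_mem_cartanSymmetries : eta r ∈ cartanSymmetries r := fun p =>
  calc cartan r p.2.reverse p.1 = cartan r p.1 p.2.reverse := cartan_comm _ _
    _ = cartan r p.2 p.1 := cartan_reverse_right _ _
    _ = cartan r p.1 p.2 := cartan_comm _ _

theorem dihedralHom_mem_cartanSymmetries (g : DihedralGroup 4) :
    dihedralHom r g ∈ cartanSymmetries r := by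
  cases g with
  | r i => exact pow_mem eta_mem_cartanSymmetries _
  | sr i => exact mul_mem ex_mem_cartanSymmetries (pow_mem eta_mem_cartanSymmetries _)

theorem actionHom_mem_cartanSymmetries (g : DihedralGroup 4 × Multiplicative (ZMod 2)) :
    actionHom r g ∈ cartanSymmetries r :=
  mul_mem (dihedralHom_mem_cartanSymmetries g.1) (pow_mem compl_mem_cartanSymmetries _)

end CartanSymmetries

end ZeroHecke

end

/-- The Cartan matrix of the 0-Hecke algebra `H_r(0)` is constant on the orbits of the action of
`D₄ × ℤ₂` on pairs of compositions of `r`. -/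
theorem mainTheorem11 (r : ℕ) (p q : Composition r × Composition r)
    (h : q ∈ MulAction.orbit (DihedralGroup 4 × Multiplicative (ZMod 2)) p) :
    ZeroHecke.cartan r q.1 q.2 = ZeroHecke.cartan r p.1 p.2 := by
  obtain ⟨g, rfl⟩ := h
  exact ZeroHecke.actionHom_mem_cartanSymmetries g p
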